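/- Let $\Sigma=\mathbb F_2$, let $\Sigma^*$ be the binary rooted tree of finite words over $\Sigma$, and let permutations of $\Sigma^*$ act on the left. For permutations $g_0,g_1$ of $\Sigma^*$ write $(g_0,g_1)$ for the permutation $\emptyset\mapsto\emptyset$, $s\sigma\mapsto s\,g_s(\sigma)$. Define $a(s\sigma)=(1-s)\sigma$ and, recursively, $\tilde b=(a,\tilde c)$, $\tilde c=(1,\tilde d)$, $\tilde d=(1,\tilde b)$, and let $\tilde G=\langle a,\tilde b,\tilde c,\tilde d\rangle$. With $[g,h]=ghg^{-1}h^{-1}$ put $x=[a,\tilde b]$, $y=[a,\tilde d]$, and let $\tilde K=\langle x,y\rangle^{\tilde G}$ and $\tilde T=\langle x^2\rangle^{\tilde G}$ be the normal closures in $\tilde G$. For a subgroup $Q$ let $Q_m=Q\times\dots\times Q$ ($2^m$ copies, acting on the subtrees below the vertices of level $m$), and for $m\ge1$ put $\tilde N_m=\tilde K_m\tilde T_{m-1}$. Let $V_n=\mathbb F_2[X_1,\dots,X_n]/(X_1^2-1,\dots,X_n^2-1)$, where the vertex $\sigma_1\dots\sigma_n$ corresponds to the monomial $X_1^{\sigma_1}\cdots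 X_n^{\sigma_n}$. For $0\le r<2^n$ with binary expansion $r=r_n\dots r_1$ let $v_n^r=(1-X_1)^{r_1}\cdots(1-X_n)^{r_n}$ and $V_n^r=\langle v_n^r,\dots,v_n^{2^n-1}\rangle$; let $V_n^r=0$ for $r\ge2^n$. Let $\gamma_1(\tilde G)=\tilde G$, $\gamma_{n+1}(\tilde G)=[\gamma_n(\tilde G),\tilde G]$. **Theorem.** 1. For all $m\ge1$, $\gamma_{2^m+1}(\tilde G)=\tilde N_m$. 2. For all $m\ge1$ there is an isomorphism $$\alpha\oplus\beta\oplus\gamma:\tilde N_m/\tilde N_{m+1}\to V_m\oplus V_m\oplus V_{m-1}$$ for which $\alpha$, $\beta$ map $(1,\dots,x,\dots,1)$, $(1,\dots,y,\dots,1)$ in $\tilde K_m$ to the monomial of $V_m$ given by the vertex in the position of $x$, $y$, and $\gamma$ maps $(1,\dots,x^2,\dots,1)\in\tilde T_{m-1}$ to the corresponding monomial of $V_{m-1}$ (the other two components being $0$ in each case); and for $r=0,\dots,2^m$, $$\gamma_{2^m+1+r}(\tilde G)=\tilde N_{m+1}\,\alpha^{-1}(V_m^r)\,\beta^{-1}(V_m^r)\,\gamma^{-1}(V_{m-1}^r),$$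 where $\alpha^{-1}(W)$, $\beta^{-1}(W)$, $\gamma^{-1}(W)$ are the preimages in $\tilde N_m$ of $W\oplus0\oplus0$, $0\oplus W\oplus0$, $0\oplus0\oplus W$. 3. For every $n\ge1$ the factor $\gamma_n(\tilde G)/\gamma_{n+1}(\tilde G)$ is an elementary abelian $2$-group, and $$\operatorname{rank}\bigl(\gamma_n(\tilde G)/\gamma_{n+1}(\tilde G)\bigr)=\begin{cases}4&\text{if }n=1,\\3&\text{if }n=2,\\3&\text{if }n=2^m+1+r,\ m\ge1,\ 0\le r<2^{m-1},\\2&\text{if }n=2^m+1+r,\ m\ge1,\ 2^{m-1}\le r<2^m,\end{cases}$$ where the rank of an abelian group $M$ is $\dim_{\mathbb F_2}(M\otimes\mathbb F_2)$. 4. $\tilde G$ is residually-$2$ and residually nilpotent, and there is a constant $C$ with $[\gamma_n(\tilde G):\gamma_{n+1}(\tilde G)]\le C$ for all $n\ge1$; that is, $\tilde G$ has finite $C$-width. -/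

import Mathlib

open scoped Pointwise TensorProduct commutatorElement

noncomputable section

namespace GrigorchukOvergroup

/-! ### Automorphisms of the binary tree -/

/-- The vertices of the binary rooted tree: finite words over the alphabet `𝔽₂`. -/
abbrev Word : Type := List (ZMod 2)

/-- For `g = (g₀, g₁)`, the map fixing the first letter `s` of a word and acting on the
remaining word by `g s`. -/
def nodeFun (g : ZMod 2 → Word → Word) : Word → Word
  | [] => []
  | s :: w => s :: g s w

/-- The permutation `(g₀, g₁)` of the words: it fixes the first level of the tree and acts by
`g s` on the subtree below the letter `s`. -/
def node : (ZMod 2 → Equiv.Perm Word) →* Equiv.Perm Word where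
  toFun g :=
    { toFun := nodeFun fun s => g s
      invFun := nodeFun fun s => (g s).symm
      left_inv := by
        intro w
        cases w <;> simp [nodeFun]
      right_inv := by
        intro w
        cases w <;> simp [nodeFun] }
  map_one' := by
    ext1 w
    cases w <;> simp [nodeFun]
  map_mul' g h := by
    ext1 w
    cases w <;> simp [nodeFun]

/-- `a(sσ) = (1 - s)σ`. -/
def aFun : Word → Word
  | [] => []
  | s :: w => (1 - s) :: w

mutual

/-- `b(0sσ) = 0(1 - s)σ`, `b(1σ) = 1c(σ)`. -/
def bFun : Word → Word
  | [] => []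
  | s :: w => if s = 0 then s :: aFun w else s :: cFun w

/-- `c(0σ) = 0σ`, `c(1σ) = 1d(σ)`. -/
def cFun : Word → Word
  | [] => []
  | s :: w => if s = 0 then s :: w else s :: dFun w

/-- `d(0σ) = 0σ`, `d(1σ) = 1b(σ)`. -/
def dFun : Word → Word
  | [] => []
  | s :: w => if s = 0 then s :: w else s :: bFun w

end

lemma aFun_involutive : Function.Involutive aFun := by
  intro w
  cases w <;> simp [aFun]

lemma bcdFun_involutive (w : Word) :
    bFun (bFun w) = w ∧ cFun (cFun w) = w ∧ dFun (dFun w) = w := by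
  induction w with
  | nil => simp [bFun, cFun, dFun]
  | cons s w ih =>
    by_cases hs : s = 0
    · simp [bFun, cFun, dFun, hs, aFun_involutive w]
    · simp [bFun, cFun, dFun, hs, ih]

/-- The generator `a`. -/
def a : Equiv.Perm Word := aFun_involutive.toPerm

/-- The generator `b̃`. -/
def b : Equiv.Perm Word :=
  Function.Involutive.toPerm bFun fun w => (bcdFun_involutive w).1

/-- The generator `c̃`. -/
def c : Equiv.Perm Word :=
  Function.Involutive.toPerm cFun fun w => (bcdFun_involutive w).2.1

/-- The generator `d̃`. -/
def d : Equiv.Perm Word :=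
  Function.Involutive.toPerm dFun fun w => (bcdFun_involutive w).2.2

/-- The group `G̃ = ⟨a, b̃, c̃, d̃⟩`, as a group of permutations of the vertices of the tree. -/
def Gt : Subgroup (Equiv.Perm Word) := Subgroup.closure {a, b, c, d}

/-- `x = [a, b̃]`, with `[g, h] = g h g⁻¹ h⁻¹`. -/
def x : Equiv.Perm Word := ⁅a, b⁆

/-- `y = [a, d̃]`. -/
def y : Equiv.Perm Word := ⁅a, d⁆

/-- The subgroup `⟨S⟩^G` generated by the conjugates of the elements of `S` by elements
of `G`. -/
def conjClosure (G : Subgroup (Equiv.Perm Word)) (S : Set (Equiv.Perm Word)) :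
    Subgroup (Equiv.Perm Word) :=
  Subgroup.closure {h | ∃ g ∈ G, ∃ s ∈ S, h = g * s * g⁻¹}

/-- `K̃ = ⟨x, y⟩^G̃`. -/
def Kt : Subgroup (Equiv.Perm Word) := conjClosure Gt {x, y}

/-- `T̃ = ⟨x²⟩^G̃`. -/
def Tt : Subgroup (Equiv.Perm Word) := conjClosure Gt {x ^ 2}

/-- `Q_m = Q × ⋯ × Q` (`2 ^ m` factors), each factor acting on the subtree below the
corresponding vertex of level `m`. -/
def level (Q : Subgroup (Equiv.Perm Word)) : ℕ → Subgroup (Equiv.Perm Word)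
  | 0 => Q
  | m + 1 => (Subgroup.pi Set.univ fun _ : ZMod 2 => level Q m).map node

/-- `Ñ_m = K̃_m T̃_{m-1}`, for `m ≥ 1`. -/
def Nt (m : ℕ) : Subgroup (Equiv.Perm Word) := level Kt m ⊔ level Tt (m - 1)

/-- The tuple `(1, …, 1, g, 1, …, 1)` with `g` in the position of the vertex `σ`: it acts by `g`
on the subtree below `σ`, and trivially on the vertices outside of this subtree. -/
def atVertex (g : Equiv.Perm Word) : Word → Equiv.Perm Word
  | [] => g
  | s :: w => node (Pi.mulSingle s (atVertex g w))

/-! ### The modules `V_n` and their filtration -/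

/-- `V_n = 𝔽₂[X₁, …, X_n] / (X₁² - 1, …, X_n² - 1)`, the group algebra over `𝔽₂` of `(ℤ/2)ⁿ`.
Its basis of monomials is indexed by the vertices of level `n`. -/
abbrev V (n : ℕ) : Type := AddMonoidAlgebra (ZMod 2) (Fin n → ZMod 2)

/-- The monomial `X₁ ^ σ₁ ⋯ X_n ^ σ_n`. -/
def monom {n : ℕ} (σ : Fin n → ZMod 2) : V n := AddMonoidAlgebra.single σ 1

/-- `v_n^r = (1 - X₁) ^ r₁ ⋯ (1 - X_n) ^ r_n`, where `r = r_n … r₁` in base `2`. Position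
`i : Fin n` stands for the variable `X_{i+1}`, so its exponent is the coefficient of `2 ^ i`. -/
def v (n r : ℕ) : V n :=
  ∏ i : Fin n, (1 - monom (Pi.single i 1)) ^ (r / 2 ^ (i : ℕ) % 2)

/-- `V_n^r`, the span of `v_n^r, …, v_n^{2^n - 1}`; it is zero for `r ≥ 2 ^ n`. -/
def Vfil (n r : ℕ) : Submodule (ZMod 2) (V n) :=
  Submodule.span (ZMod 2) {f | ∃ s, r ≤ s ∧ s < 2 ^ n ∧ f = v n s}

/-! ### The isomorphism `α ⊕ β ⊕ γ` -/

/-- `Φ`, seen as a map on `Ñ_m / Ñ_{m+1}`, is the isomorphism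
`α ⊕ β ⊕ γ : Ñ_m / Ñ_{m+1} → V_m ⊕ V_m ⊕ V_{m-1}`: it is onto with kernel `Ñ_{m+1}`,
and it sends `(1, …, x, …, 1)`, `(1, …, y, …, 1)` (at a vertex of level `m`) and
`(1, …, x², …, 1)` (at a vertex of level `m - 1`) to the monomial of the vertex in the first,
second and third summand. -/
structure IsAlphaBetaGamma (m : ℕ) (Φ : Nt m →* Multiplicative (V m × V m × V (m - 1))) :
    Prop where
  surjective : Function.Surjective Φ
  ker : Φ.ker.map (Nt m).subtype = Nt (m + 1)
  map_x : ∀ σ : Fin m → ZMod 2, ∃ h : atVertex x (List.ofFn σ) ∈ Nt m,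
    Φ ⟨_, h⟩ = Multiplicative.ofAdd (monom σ, 0, 0)
  map_y : ∀ σ : Fin m → ZMod 2, ∃ h : atVertex y (List.ofFn σ) ∈ Nt m,
    Φ ⟨_, h⟩ = Multiplicative.ofAdd (0, monom σ, 0)
  map_x_sq : ∀ σ : Fin (m - 1) → ZMod 2, ∃ h : atVertex (x ^ 2) (List.ofFn σ) ∈ Nt m,
    Φ ⟨_, h⟩ = Multiplicative.ofAdd (0, 0, monom σ)

section Inverse

variable {m : ℕ} (Φ : Nt m →* Multiplicative (V m × V m × V (m - 1)))

/-- The elements of `Ñ_m` whose class modulo `Ñ_{m+1}` lies in `α⁻¹(W)`. -/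
def alphaInv (W : Submodule (ZMod 2) (V m)) : Subgroup (Equiv.Perm Word) :=
  ((W.prod (⊥ : Submodule (ZMod 2) (V m × V (m - 1)))).toAddSubgroup.toSubgroup.comap Φ).map
    (Nt m).subtype

/-- The elements of `Ñ_m` whose class modulo `Ñ_{m+1}` lies in `β⁻¹(W)`. -/
def betaInv (W : Submodule (ZMod 2) (V m)) : Subgroup (Equiv.Perm Word) :=
  (((⊥ : Submodule (ZMod 2) (V m)).prod
    (W.prod (⊥ : Submodule (ZMod 2) (V (m - 1))))).toAddSubgroup.toSubgroup.comap Φ).map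
    (Nt m).subtype

/-- The elements of `Ñ_m` whose class modulo `Ñ_{m+1}` lies in `γ⁻¹(W)`. -/
def gammaInv (W : Submodule (ZMod 2) (V (m - 1))) : Subgroup (Equiv.Perm Word) :=
  (((⊥ : Submodule (ZMod 2) (V m)).prod
    ((⊥ : Submodule (ZMod 2) (V m)).prod W)).toAddSubgroup.toSubgroup.comap Φ).map
    (Nt m).subtype

end Inverse

/-! ### Lower central series, ranks, and width -/

section LowerCentral

variable {P : Type*} [Group P]

/-- `γ_n(G)` for `n ≥ 1`, where `γ_1(G) = G` and `γ_{n+1}(G) = [γ_n(G), G]`. -/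
def lcs (G : Subgroup P) (n : ℕ) : Subgroup P := G.lowerCentralSeries (n - 1)

lemma lcs_commutator_mem (G : Subgroup P) (n : ℕ) {g h : P} (hg : g ∈ lcs G n)
    (hh : h ∈ lcs G n) : ⁅g, h⁆ ∈ lcs G (n + 1) := by
  rcases n with _ | n
  · exact Subgroup.commutator_le_self _ (Subgroup.commutator_mem_commutator hg hh)
  · exact Subgroup.commutator_mem_commutator hg
      (G.lowerCentralSeries_antitone (Nat.zero_le _) hh)

/-- The factor `γ_n(G) / γ_{n+1}(G)`. -/
abbrev LCFactor (G : Subgroup P) (n : ℕ) : Type _ :=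
  lcs G n ⧸ (lcs G (n + 1)).subgroupOf (lcs G n)

instance lcs_subgroupOf_normal (G : Subgroup P) (n : ℕ) :
    ((lcs G (n + 1)).subgroupOf (lcs G n)).Normal where
  conj_mem g hg h := by
    rw [Subgroup.mem_subgroupOf] at hg ⊢
    have key := (lcs G (n + 1)).mul_mem (lcs_commutator_mem G n h.2 g.2) hg
    simpa [commutatorElement_def] using key

/-- The lower central factors are abelian. -/
instance (G : Subgroup P) (n : ℕ) : CommGroup (LCFactor G n) :=
  { (inferInstance : Group (LCFactor G n)) with
    mul_comm := by
      intro p q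
      induction p using QuotientGroup.induction_on with
      | H g =>
        induction q using QuotientGroup.induction_on with
        | H h =>
          rw [← QuotientGroup.mk_mul, ← QuotientGroup.mk_mul, QuotientGroup.eq,
            Subgroup.mem_subgroupOf]
          have key := lcs_commutator_mem G n (inv_mem h.2) (inv_mem g.2)
          simpa [commutatorElement_def, mul_assoc] using key }

/-- The rank of an abelian `2`-group `M`: the dimension over `𝔽₂` of `M ⊗ 𝔽₂`. -/
def rank₂ (M : Type*) [CommGroup M] : ℕ :=
  Module.finrank (ZMod 2) (ZMod 2 ⊗[ℤ] Additive M)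

/-- `G` is residually nilpotent: the terms of its lower central series intersect trivially. -/
def IsResiduallyNilpotent (G : Subgroup P) : Prop :=
  ⨅ n : ℕ, lcs G n = ⊥

/-- Residually-`p`: each non-trivial element survives in a quotient that is a finite `p`-group. -/
def IsResiduallyP (p : ℕ) (G : Type*) [Group G] : Prop :=
  ∀ g : G, g ≠ 1 → ∃ N : Subgroup G, N.Normal ∧ (∃ k : ℕ, N.index = p ^ k) ∧ g ∉ N

/-- Finite `C`-width: `G` is residually nilpotent, and the indices `[γ_n(G) : γ_{n+1}(G)]`,
`n ≥ 1`, are finite and uniformly bounded. (An infinite index is `0` in Mathlib.) -/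
def HasFiniteCWidth (G : Subgroup P) : Prop :=
  IsResiduallyNilpotent G ∧
    ∃ C : ℕ, ∀ n, 1 ≤ n →
      (lcs G (n + 1)).relIndex (lcs G n) ≠ 0 ∧ (lcs G (n + 1)).relIndex (lcs G n) ≤ C

end LowerCentral

end GrigorchukOvergroup

end

noncomputable section

namespace GrigorchukOvergroup

/-! ### The wreath recursion -/

-- Each quotient of consecutive `Nt m` is an `𝔽₂`-module on which `G̃` acts by permuting the
-- vertices of a level. Taking commutators with `g` amounts to applying `g - 1` to this module, so
-- the lower central series comes from iterating these operators.
--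
-- The base is explicit: `x = (ca, ac)`, `y = (b, b)`, `z = [a, c̃] = (d, d)`, `x² = (z, z)`. A
-- short table of commutators then gives `lcs_three_eq`.
--
-- Coordinates come from parities of portraits. The characters `sgn n` of `G̃`, evaluated on a
-- first-level section, become `G̃`-invariant characters `psi n` of `γ₂`, and `psi 0`, `psi 1`, `psi
-- 2` are dual to `x`, `y`, `z` modulo `Nt 1`. On `Nt 1` the two sections have the same `psi 2`;
-- this common value is the character `theta`, trivial on the pairs from `Kt` and non-trivial on
-- `x²`. Reading `psi 0` and `psi 1` at the vertices of level `m`, and `theta` at those of level `m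
-- - 1`, gives `α ⊕ β ⊕ γ`, with the kernel found in `phiFun_eq_zero_iff`.
--
-- On functions on a level, `g - 1` maps each layer of the filtration into the next (`act_sub_mem`),
-- and for every `r` some generator moves `w n r` to `w n (r + 1)` modulo later layers
-- (`exists_act_w`). So in coordinates the commutators of one layer with `G̃` fill the next layer
-- exactly. To lift this to groups, the commutator subgroup must also contain the kernel. It does
-- because `(x, …, x)` lies in the last layer and its commutators with `b`, `c`, `d` normally
-- generate the next `Nt` (`Nt_le_of_commutator_diag_mem`). These facts combine in
-- `commutator_NtFil`, from which `lcs_eq_NtFil` follows by induction. Each step lowers by one the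
-- dimension of every summand not yet exhausted; the third summand has half the dimension of the
-- others, so the rank falls from 3 to 2 halfway.

lemma zmod_two_cases (s : ZMod 2) : s = 0 ∨ s = 1 := by
  revert s; decide

lemma zmod_two_add_self (s : ZMod 2) : s + s = 0 := by
  revert s; decide

lemma a_apply_cons (s : ZMod 2) (w : Word) : a (s :: w) = (1 - s) :: w := rfl

lemma node_apply_nil (p : ZMod 2 → Equiv.Perm Word) : node p [] = [] := rfl

lemma node_apply_cons (p : ZMod 2 → Equiv.Perm Word) (s : ZMod 2) (w : Word) :
    node p (s :: w) = s :: p s w := rfl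

lemma node_injective : Function.Injective node := by
  intro p q h
  ext1 s
  ext1 w
  have h1 : node p (s :: w) = node q (s :: w) := by rw [h]
  simpa [node_apply_cons] using h1

/-- The pair `(g₀, g₁)`, indexed by the letters. -/
def pair (g h : Equiv.Perm Word) : ZMod 2 → Equiv.Perm Word := fun s => if s = 0 then g else h

@[simp] lemma pair_zero (g h : Equiv.Perm Word) : pair g h 0 = g := rfl

@[simp] lemma pair_one (g h : Equiv.Perm Word) : pair g h 1 = h := rfl

lemma pair_mul (g h g' h' : Equiv.Perm Word) :
    pair g h * pair g' h' = pair (g * g') (h * h') := by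
  ext1 s
  rcases zmod_two_cases s with rfl | rfl <;> simp

lemma pair_inv (g h : Equiv.Perm Word) : (pair g h)⁻¹ = pair g⁻¹ h⁻¹ := by
  ext1 s
  rcases zmod_two_cases s with rfl | rfl <;> simp

lemma pair_one_one : pair 1 1 = 1 := by
  ext1 s
  rcases zmod_two_cases s with rfl | rfl <;> simp

lemma pair_eta (p : ZMod 2 → Equiv.Perm Word) : pair (p 0) (p 1) = p := by
  ext1 s
  rcases zmod_two_cases s with rfl | rfl <;> simp

lemma mulSingle_zero_eq_pair (g : Equiv.Perm Word) : Pi.mulSingle (0 : ZMod 2) g = pair g 1 := by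
  ext1 s
  rcases zmod_two_cases s with rfl | rfl <;> simp [Pi.mulSingle]

lemma mulSingle_one_eq_pair (g : Equiv.Perm Word) : Pi.mulSingle (1 : ZMod 2) g = pair 1 g := by
  ext1 s
  rcases zmod_two_cases s with rfl | rfl <;> simp [Pi.mulSingle]

lemma eq_mulSingle_mul (p : ZMod 2 → Equiv.Perm Word) :
    p = Pi.mulSingle 0 (p 0) * Pi.mulSingle 1 (p 1) := by
  rw [mulSingle_zero_eq_pair, mulSingle_one_eq_pair, pair_mul, mul_one, one_mul, pair_eta]

lemma node_pair_mul (g h g' h' : Equiv.Perm Word) :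
    node (pair g h) * node (pair g' h') = node (pair (g * g') (h * h')) := by
  rw [← map_mul, pair_mul]

lemma node_pair_inv (g h : Equiv.Perm Word) :
    (node (pair g h))⁻¹ = node (pair g⁻¹ h⁻¹) := by
  rw [← map_inv, pair_inv]

lemma commutator_node_pair (g h g' h' : Equiv.Perm Word) :
    ⁅node (pair g h), node (pair g' h')⁆ = node (pair ⁅g, g'⁆ ⁅h, h'⁆) := by
  simp only [commutatorElement_def, node_pair_inv, node_pair_mul]

lemma a_mul_a : a * a = 1 := by
  ext1 w; exact aFun_involutive w

lemma b_mul_b : b * b = 1 := by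
  ext1 w; exact (bcdFun_involutive w).1

lemma c_mul_c : c * c = 1 := by
  ext1 w; exact (bcdFun_involutive w).2.1

lemma d_mul_d : d * d = 1 := by
  ext1 w; exact (bcdFun_involutive w).2.2

lemma a_inv : a⁻¹ = a := inv_eq_of_mul_eq_one_left a_mul_a
lemma b_inv : b⁻¹ = b := inv_eq_of_mul_eq_one_left b_mul_b
lemma c_inv : c⁻¹ = c := inv_eq_of_mul_eq_one_left c_mul_c
lemma d_inv : d⁻¹ = d := inv_eq_of_mul_eq_one_left d_mul_d

lemma b_eq : b = node (pair a c) := by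
  ext1 w
  cases w with
  | nil => rfl
  | cons s w =>
    change bFun (s :: w) = _
    rcases zmod_two_cases s with rfl | rfl <;> simp [bFun, node_apply_cons] <;> rfl

lemma c_eq : c = node (pair 1 d) := by
  ext1 w
  cases w with
  | nil => rfl
  | cons s w =>
    change cFun (s :: w) = _
    rcases zmod_two_cases s with rfl | rfl
    · simp [cFun, node_apply_cons]
    · simp [cFun, node_apply_cons]; rfl

lemma d_eq : d = node (pair 1 b) := by
  ext1 w
  cases w with
  | nil => rfl
  | cons s w =>
    change dFun (s :: w) = _
    rcases zmod_two_cases s with rfl | rfl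
    · simp [dFun, node_apply_cons]
    · simp [dFun, node_apply_cons]; rfl

/-- The power `a ^ i`, which adds `i` to the first letter. -/
def aPow (i : ZMod 2) : Equiv.Perm Word := if i = 0 then 1 else a

@[simp] lemma aPow_zero : aPow 0 = 1 := rfl

@[simp] lemma aPow_one : aPow 1 = a := rfl

lemma aPow_add (i j : ZMod 2) : aPow (i + j) = aPow i * aPow j := by
  rcases zmod_two_cases i with rfl | rfl <;> rcases zmod_two_cases j with rfl | rfl <;>
    simp [zmod_two_add_self, a_mul_a]

lemma aPow_mul_self (i : ZMod 2) : aPow i * aPow i = 1 := by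
  rw [← aPow_add, zmod_two_add_self, aPow_zero]

lemma aPow_inv (i : ZMod 2) : (aPow i)⁻¹ = aPow i :=
  inv_eq_of_mul_eq_one_left (aPow_mul_self i)

lemma aPow_apply_cons (i s : ZMod 2) (w : Word) : aPow i (s :: w) = (s + i) :: w := by
  rcases zmod_two_cases i with rfl | rfl
  · simp
  · rw [aPow_one, a_apply_cons, CharTwo.sub_eq_add, add_comm]

lemma aPow_apply_nil (i : ZMod 2) : aPow i [] = [] := by
  rcases zmod_two_cases i with rfl | rfl <;> rfl

/-- Moving a power of `a` past a pair swaps its entries. All formulas for products, inverses and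
conjugates in wreath form reduce to this. -/
lemma node_mul_aPow (p : ZMod 2 → Equiv.Perm Word) (i : ZMod 2) :
    node p * aPow i = aPow i * node fun s => p (s + i) := by
  ext1 w
  cases w with
  | nil => simp [aPow_apply_nil, node_apply_nil]
  | cons s w => simp [aPow_apply_cons, node_apply_cons]

lemma aPow_mul_node (p : ZMod 2 → Equiv.Perm Word) (i : ZMod 2) :
    aPow i * node p = node (fun s => p (s + i)) * aPow i := by
  rw [node_mul_aPow]
  simp [add_assoc, zmod_two_add_self]

lemma aPow_conj_node (p : ZMod 2 → Equiv.Perm Word) (i : ZMod 2) :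
    aPow i * node p * aPow i = node fun s => p (s + i) := by
  rw [aPow_mul_node, mul_assoc, aPow_mul_self, mul_one]

lemma a_conj_node_pair (g h : Equiv.Perm Word) :
    a * node (pair g h) * a = node (pair h g) := by
  rw [← aPow_one, aPow_conj_node, ← pair_eta fun s => pair g h (s + 1)]
  simp [zmod_two_add_self]

lemma wreath_mul (i j : ZMod 2) (p q : ZMod 2 → Equiv.Perm Word) :
    aPow i * node p * (aPow j * node q) = aPow (i + j) * node fun s => p (s + j) * q s := by
  rw [mul_assoc, ← mul_assoc (node p), node_mul_aPow, aPow_add, mul_assoc (aPow j), ← map_mul,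
    mul_assoc]
  rfl

lemma wreath_inv (i : ZMod 2) (p : ZMod 2 → Equiv.Perm Word) :
    (aPow i * node p)⁻¹ = aPow i * node fun s => (p (s + i))⁻¹ := by
  rw [mul_inv_rev, ← map_inv, aPow_inv, node_mul_aPow]
  rfl

lemma wreath_conj_node (i : ZMod 2) (p q : ZMod 2 → Equiv.Perm Word) :
    aPow i * node p * node q * (aPow i * node p)⁻¹ =
      node fun s => p (s + i) * q (s + i) * (p (s + i))⁻¹ := by
  have h := aPow_conj_node (p * q * p⁻¹) i
  rw [map_mul, map_mul, map_inv] at h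
  rw [mul_inv_rev, aPow_inv]
  simp only [mul_assoc] at h ⊢
  exact h

/-- The action on the first level. -/
def root (g : Equiv.Perm Word) : ZMod 2 := (g [0]).headD 0

/-- The sections on the first level. -/
def sec (g : Equiv.Perm Word) : ZMod 2 → Equiv.Perm Word :=
  -- Meaningful only when the argument is in the range of `node`, in particular for elements in
  -- wreath form; elsewhere `invFun` returns an arbitrary value.
  Function.invFun node (aPow (root g) * g)

@[simp] lemma root_wreath (i : ZMod 2) (p : ZMod 2 → Equiv.Perm Word) :
    root (aPow i * node p) = i := by
  simp [root, node_apply_cons, aPow_apply_cons]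

@[simp] lemma sec_wreath (i : ZMod 2) (p : ZMod 2 → Equiv.Perm Word) :
    sec (aPow i * node p) = p := by
  rw [sec, root_wreath, ← mul_assoc, aPow_mul_self, one_mul]
  exact Function.leftInverse_invFun node_injective p

@[simp] lemma root_node (p : ZMod 2 → Equiv.Perm Word) : root (node p) = 0 :=
  root_wreath 0 p

@[simp] lemma sec_node (p : ZMod 2 → Equiv.Perm Word) : sec (node p) = p :=
  sec_wreath 0 p

@[simp] lemma root_a : root a = 1 := by simpa using root_wreath 1 1

@[simp] lemma sec_a : sec a = 1 := by simpa using sec_wreath 1 1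

lemma a_mem_Gt : a ∈ Gt := Subgroup.subset_closure (by simp)
lemma b_mem_Gt : b ∈ Gt := Subgroup.subset_closure (by simp)
lemma c_mem_Gt : c ∈ Gt := Subgroup.subset_closure (by simp)
lemma d_mem_Gt : d ∈ Gt := Subgroup.subset_closure (by simp)

lemma aPow_mem_Gt (i : ZMod 2) : aPow i ∈ Gt := by
  rcases zmod_two_cases i with rfl | rfl
  · exact one_mem _
  · exact a_mem_Gt

/-- The sections of the generators are again generators or trivial, and the wreath form is closed
under products and inverses. -/
lemma exists_wreath_of_mem_Gt {g : Equiv.Perm Word} (hg : g ∈ Gt) :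
    ∃ i p, (∀ s, p s ∈ Gt) ∧ g = aPow i * node p := by
  induction hg using Subgroup.closure_induction with
  | mem g hg =>
    have key : ∀ g h, g ∈ Gt → h ∈ Gt → ∀ s, pair g h s ∈ Gt := by
      intro g h hg hh s
      rcases zmod_two_cases s with rfl | rfl <;> simpa
    rcases hg with rfl | rfl | rfl | rfl
    · exact ⟨1, 1, fun _ => one_mem _, by simp⟩
    · exact ⟨0, pair a c, key _ _ a_mem_Gt c_mem_Gt, by simpa using b_eq⟩
    · exact ⟨0, pair 1 d, key _ _ (one_mem _) d_mem_Gt, by simpa using c_eq⟩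
    · exact ⟨0, pair 1 b, key _ _ (one_mem _) b_mem_Gt, by simpa using d_eq⟩
  | one => exact ⟨0, 1, fun _ => one_mem _, by simp⟩
  | mul g h _ _ ihg ihh =>
    obtain ⟨i, p, hp, rfl⟩ := ihg
    obtain ⟨j, q, hq, rfl⟩ := ihh
    exact ⟨_, _, fun s => mul_mem (hp _) (hq _), wreath_mul i j p q⟩
  | inv g _ ih =>
    obtain ⟨i, p, hp, rfl⟩ := ih
    exact ⟨_, _, fun s => inv_mem (hp _), wreath_inv i p⟩

lemma eq_wreath {g : Equiv.Perm Word} (hg : g ∈ Gt) : g = aPow (root g) * node (sec g) := by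
  obtain ⟨i, p, -, rfl⟩ := exists_wreath_of_mem_Gt hg
  simp

lemma sec_mem_Gt {g : Equiv.Perm Word} (hg : g ∈ Gt) (s : ZMod 2) : sec g s ∈ Gt := by
  obtain ⟨i, p, hp, rfl⟩ := exists_wreath_of_mem_Gt hg
  simpa using hp s

lemma eq_node_of_root_eq_zero {g : Equiv.Perm Word} (hg : g ∈ Gt) (h : root g = 0) :
    g = node (sec g) := by
  simpa [h] using eq_wreath hg

lemma root_mul {g h : Equiv.Perm Word} (hg : g ∈ Gt) (hh : h ∈ Gt) :
    root (g * h) = root g + root h := by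
  obtain ⟨i, p, -, rfl⟩ := exists_wreath_of_mem_Gt hg
  obtain ⟨j, q, -, rfl⟩ := exists_wreath_of_mem_Gt hh
  simp only [wreath_mul, root_wreath]

lemma sec_mul {g h : Equiv.Perm Word} (hg : g ∈ Gt) (hh : h ∈ Gt) (s : ZMod 2) :
    sec (g * h) s = sec g (s + root h) * sec h s := by
  obtain ⟨i, p, -, rfl⟩ := exists_wreath_of_mem_Gt hg
  obtain ⟨j, q, -, rfl⟩ := exists_wreath_of_mem_Gt hh
  simp only [wreath_mul, sec_wreath, root_wreath]

/-- `G̃` is self-replicating. -/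
lemma exists_node_mem_Gt (s : ZMod 2) {g : Equiv.Perm Word} (hg : g ∈ Gt) :
    ∃ p, p s = g ∧ node p ∈ Gt := by
  have hba : node (pair c a) ∈ Gt := by
    rw [← a_conj_node_pair, ← b_eq]
    exact mul_mem (mul_mem a_mem_Gt b_mem_Gt) a_mem_Gt
  have hca : node (pair d 1) ∈ Gt := by
    rw [← a_conj_node_pair, ← c_eq]
    exact mul_mem (mul_mem a_mem_Gt c_mem_Gt) a_mem_Gt
  have hda : node (pair b 1) ∈ Gt := by
    rw [← a_conj_node_pair, ← d_eq]
    exact mul_mem (mul_mem a_mem_Gt d_mem_Gt) a_mem_Gt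
  have hb := b_mem_Gt
  have hc := c_mem_Gt
  have hd := d_mem_Gt
  rw [b_eq] at hb
  rw [c_eq] at hc
  rw [d_eq] at hd
  induction hg using Subgroup.closure_induction with
  | mem g hg =>
    rcases zmod_two_cases s with rfl | rfl <;> rcases hg with rfl | rfl | rfl | rfl
    -- The eight witnesses are `b = (a, c)`, `c = (1, d)`, `d = (1, b)` and their conjugates by `a`.
    -- Each of the four generators occurs as an entry on either side.
    exacts [⟨_, rfl, hb⟩, ⟨_, rfl, hda⟩, ⟨_, rfl, hba⟩, ⟨_, rfl, hca⟩,
      ⟨_, rfl, hba⟩, ⟨_, rfl, hd⟩, ⟨_, rfl, hb⟩, ⟨_, rfl, hc⟩]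
  | one => exact ⟨1, rfl, by rw [map_one]; exact one_mem _⟩
  | mul g h _ _ ihg ihh =>
    obtain ⟨p, rfl, hp⟩ := ihg
    obtain ⟨q, rfl, hq⟩ := ihh
    exact ⟨p * q, rfl, by rw [map_mul]; exact mul_mem hp hq⟩
  | inv g _ ih =>
    obtain ⟨p, rfl, hp⟩ := ih
    exact ⟨p⁻¹, rfl, by rw [map_inv]; exact inv_mem hp⟩

/-! ### Subgroups normalised by a group -/

section NormBy

variable {P : Type*} [Group P]

/-- `Q` is stable under conjugation by the elements of `G`. -/
def NormBy (G Q : Subgroup P) : Prop := ∀ g ∈ G, ∀ q ∈ Q, g * q * g⁻¹ ∈ Q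

lemma normBy_self (G : Subgroup P) : NormBy G G :=
  fun _ hg _ hq => mul_mem (mul_mem hg hq) (inv_mem hg)

lemma NormBy.sup {G Q R : Subgroup P} (hQ : NormBy G Q) (hR : NormBy G R) : NormBy G (Q ⊔ R) := by
  intro g hg q hq
  have h : Q ⊔ R ≤ (Q ⊔ R).comap (MulAut.conj g).toMonoidHom :=
    sup_le (fun q hq => Subgroup.mem_sup_left (hQ g hg q hq))
      fun q hq => Subgroup.mem_sup_right (hR g hg q hq)
  exact h hq

lemma normBy_closure {G : Subgroup P} {X : Set P}
    (h : ∀ g ∈ G, ∀ q ∈ X, g * q * g⁻¹ ∈ Subgroup.closure X) :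
    NormBy G (Subgroup.closure X) := by
  intro g hg q hq
  have h' : Subgroup.closure X ≤ (Subgroup.closure X).comap (MulAut.conj g).toMonoidHom :=
    (Subgroup.closure_le _).2 fun q hq => h g hg q hq
  exact h' hq

lemma NormBy.commutator {G Q : Subgroup P} (hQ : NormBy G Q) : NormBy G ⁅Q, G⁆ := by
  rw [Subgroup.commutator_def]
  apply normBy_closure
  rintro g hg _ ⟨q, hq, h, hh, rfl⟩
  rw [← MulAut.conj_apply, map_commutatorElement]
  exact Subgroup.subset_closure ⟨_, hQ g hg q hq, _, normBy_self G g hg h hh, rfl⟩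

lemma NormBy.commutator_le {G Q : Subgroup P} (hQ : NormBy G Q) : ⁅Q, G⁆ ≤ Q := by
  rw [Subgroup.commutator_le]
  intro q hq g hg
  rw [commutatorElement_def, mul_assoc, mul_assoc, ← mul_assoc g]
  exact mul_mem hq (hQ g hg _ (inv_mem hq))

/-- A commutator subgroup lies in `N` as soon as the commutators of the generators do. -/
lemma commutator_closure_le {N : Subgroup P} {X Y : Set P} (hX : NormBy (Subgroup.closure X) N)
    (hY : NormBy (Subgroup.closure Y) N) (h : ∀ s ∈ X, ∀ t ∈ Y, ⁅s, t⁆ ∈ N) :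
    ⁅Subgroup.closure X, Subgroup.closure Y⁆ ≤ N := by
  rw [Subgroup.commutator_le]
  intro s hs t ht
  induction hs using Subgroup.closure_induction with
  | mem s hs =>
    induction ht using Subgroup.closure_induction with
    | mem t ht => exact h s hs t ht
    | one => simp
    | mul t u ht hu iht ihu =>
      have : ⁅s, t * u⁆ = ⁅s, t⁆ * (t * ⁅s, u⁆ * t⁻¹) := by
        simp only [commutatorElement_def]; group
      rw [this]
      exact mul_mem iht (hY t ht _ ihu)
    | inv t ht iht =>
      have : ⁅s, t⁻¹⁆ = t⁻¹ * ⁅s, t⁆⁻¹ * t⁻¹⁻¹ := by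
        simp only [commutatorElement_def]; group
      rw [this]
      exact hY _ (inv_mem ht) _ (inv_mem iht)
  | one => simp
  | mul s u hs hu ihs ihu =>
    have : ⁅s * u, t⁆ = s * ⁅u, t⁆ * s⁻¹ * ⁅s, t⁆ := by
      simp only [commutatorElement_def]; group
    rw [this]
    exact mul_mem (hX s hs _ ihu) ihs
  | inv s hs ihs =>
    have : ⁅s⁻¹, t⁆ = s⁻¹ * ⁅s, t⁆⁻¹ * s⁻¹⁻¹ := by
      simp only [commutatorElement_def]; group
    rw [this]
    exact hX _ (inv_mem hs) _ (inv_mem ihs)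

end NormBy

-- Normal closures in `G̃`

lemma subset_conjClosure (G : Subgroup (Equiv.Perm Word)) {S : Set (Equiv.Perm Word)}
    {s : Equiv.Perm Word} (hs : s ∈ S) : s ∈ conjClosure G S :=
  Subgroup.subset_closure ⟨1, one_mem _, s, hs, by simp⟩

lemma normBy_conjClosure (G : Subgroup (Equiv.Perm Word)) (S : Set (Equiv.Perm Word)) :
    NormBy G (conjClosure G S) := by
  apply normBy_closure
  rintro g hg _ ⟨h, hh, s, hs, rfl⟩
  exact Subgroup.subset_closure ⟨g * h, mul_mem hg hh, s, hs, by group⟩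

lemma conjClosure_le {G Q : Subgroup (Equiv.Perm Word)} {S : Set (Equiv.Perm Word)}
    (hQ : NormBy G Q) (hS : S ⊆ Q) : conjClosure G S ≤ Q := by
  rw [conjClosure, Subgroup.closure_le]
  rintro _ ⟨g, hg, s, hs, rfl⟩
  exact hQ g hg s (hS hs)

/-! ### Level subgroups -/

variable {Q R : Subgroup (Equiv.Perm Word)}

lemma mem_level_succ {m : ℕ} {g : Equiv.Perm Word} :
    g ∈ level Q (m + 1) ↔ ∃ p, (∀ s, p s ∈ level Q m) ∧ node p = g := by
  simp [level, Subgroup.mem_map, Subgroup.mem_pi]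

@[simp] lemma node_mem_level_succ {m : ℕ} {p : ZMod 2 → Equiv.Perm Word} :
    node p ∈ level Q (m + 1) ↔ ∀ s, p s ∈ level Q m := by
  rw [mem_level_succ]
  constructor
  · rintro ⟨q, hq, h⟩
    rwa [← node_injective h]
  · intro h
    exact ⟨p, h, rfl⟩

lemma node_pair_mem_level_succ {m : ℕ} {g h : Equiv.Perm Word} :
    node (pair g h) ∈ level Q (m + 1) ↔ g ∈ level Q m ∧ h ∈ level Q m := by
  rw [node_mem_level_succ]
  constructor
  · intro H
    exact ⟨H 0, H 1⟩
  · rintro ⟨hg, hh⟩ s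
    rcases zmod_two_cases s with rfl | rfl <;> simpa

lemma level_mono (h : Q ≤ R) (m : ℕ) : level Q m ≤ level R m := by
  induction m with
  | zero => exact h
  | succ m ih =>
    intro g hg
    obtain ⟨p, hp, rfl⟩ := mem_level_succ.1 hg
    exact node_mem_level_succ.2 fun s => ih (hp s)

/-- The recursion in `level` splits off the top of the tree; this form splits off the last level
instead, and so writes `Nt (m + 1)` as a level subgroup of `Nt 1`. -/
lemma level_level_one (Q : Subgroup (Equiv.Perm Word)) (m : ℕ) :
    level (level Q 1) m = level Q (m + 1) := by
  induction m with
  | zero => rfl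
  | succ m ih => rw [level, ih, level.eq_2 Q (m + 1)]

lemma level_inf (Q R : Subgroup (Equiv.Perm Word)) (m : ℕ) :
    level (Q ⊓ R) m = level Q m ⊓ level R m := by
  apply le_antisymm
  · exact le_inf (level_mono inf_le_left m) (level_mono inf_le_right m)
  · induction m with
    | zero => exact le_rfl
    | succ m ih =>
      rintro g ⟨h1, h2⟩
      obtain ⟨p, hp, rfl⟩ := mem_level_succ.1 h1
      exact node_mem_level_succ.2 fun s => ih ⟨hp s, node_mem_level_succ.1 h2 s⟩

/-- The embedding of the automorphisms of the subtree below the letter `s`. -/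
def nodeSingle (s : ZMod 2) : Equiv.Perm Word →* Equiv.Perm Word :=
  node.comp (MonoidHom.mulSingle (fun _ : ZMod 2 => Equiv.Perm Word) s)

lemma nodeSingle_apply (s : ZMod 2) (g : Equiv.Perm Word) :
    nodeSingle s g = node (Pi.mulSingle s g) := rfl

lemma node_eq_mul (p : ZMod 2 → Equiv.Perm Word) :
    node p = nodeSingle 0 (p 0) * nodeSingle 1 (p 1) := by
  rw [nodeSingle_apply, nodeSingle_apply, ← map_mul, ← eq_mulSingle_mul]

/-- A product is generated by its factors, so a containment can be tested in one subtree at a time.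
The target becomes a preimage under `nodeSingle s`, which is why inductions on the level keep it
general. -/
lemma level_succ_le {m : ℕ} {H : Subgroup (Equiv.Perm Word)}
    (h : ∀ s, level Q m ≤ H.comap (nodeSingle s)) : level Q (m + 1) ≤ H := by
  intro g hg
  obtain ⟨p, hp, rfl⟩ := mem_level_succ.1 hg
  rw [node_eq_mul]
  exact mul_mem (h 0 (hp 0)) (h 1 (hp 1))

lemma nodeSingle_mem_level {m : ℕ} (s : ZMod 2) {g : Equiv.Perm Word} (hg : g ∈ level Q m) :
    nodeSingle s g ∈ level Q (m + 1) := by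
  rw [nodeSingle_apply, node_mem_level_succ]
  intro t
  by_cases h : t = s
  · subst h; simpa
  · simp [Pi.mulSingle_eq_of_ne h]

lemma level_sup (Q R : Subgroup (Equiv.Perm Word)) (m : ℕ) :
    level (Q ⊔ R) m = level Q m ⊔ level R m := by
  apply le_antisymm
  · induction m with
    | zero => exact le_rfl
    | succ m ih =>
      refine level_succ_le fun s => ih.trans (sup_le ?_ ?_)
      · intro g hg
        exact Subgroup.mem_sup_left (nodeSingle_mem_level s hg)
      · intro g hg
        exact Subgroup.mem_sup_right (nodeSingle_mem_level s hg)
  · exact sup_le (level_mono le_sup_left m) (level_mono le_sup_right m)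

lemma level_closure_le {X : Set (Equiv.Perm Word)} (m : ℕ) {H : Subgroup (Equiv.Perm Word)}
    (h : ∀ q ∈ X, ∀ w : Word, w.length = m → atVertex q w ∈ H) :
    level (Subgroup.closure X) m ≤ H := by
  induction m generalizing H with
  | zero => exact (Subgroup.closure_le _).2 fun q hq => h q hq [] rfl
  | succ m ih =>
    refine level_succ_le fun s => ih fun q hq w hw => ?_
    exact h q hq (s :: w) (by simp [hw])

lemma atVertex_mem_level {q : Equiv.Perm Word} (hq : q ∈ Q) (w : Word) :
    atVertex q w ∈ level Q w.length := by
  induction w with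
  | nil => exact hq
  | cons s w ih => exact nodeSingle_mem_level s ih

/-- Conjugation by an element of `G̃` permutes the two factors and conjugates each by a section,
which is again in `G̃`. -/
lemma NormBy.level (h : NormBy Gt Q) (m : ℕ) : NormBy Gt (level Q m) := by
  induction m with
  | zero => exact h
  | succ m ih =>
    intro g hg q hq
    obtain ⟨i, p, hp, rfl⟩ := exists_wreath_of_mem_Gt hg
    obtain ⟨q, hq', rfl⟩ := mem_level_succ.1 hq
    rw [wreath_conj_node]
    exact node_mem_level_succ.2 fun s => ih _ (hp _) _ (hq' _)

/-- The conjugates of `(1, …, q, …, 1)` move `q` to all vertices of the level, and there they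
realise all conjugates of `q`. -/
lemma exists_conj_atVertex {w w' : Word} (hw : w.length = w'.length) {g : Equiv.Perm Word}
    (hg : g ∈ Gt) :
    ∃ h ∈ Gt, ∀ q, h * atVertex q w * h⁻¹ = atVertex (g * q * g⁻¹) w' := by
  induction w generalizing w' with
  | nil =>
    obtain rfl : w' = [] := List.length_eq_zero_iff.1 hw.symm
    exact ⟨g, hg, fun q => rfl⟩
  | cons s w ih =>
    obtain _ | ⟨s', w'⟩ := w'
    · simp at hw
    obtain ⟨h, hh, H⟩ := ih (w' := w') (by simpa using hw)
    obtain ⟨p, rfl, hp⟩ := exists_node_mem_Gt s hh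
    -- `aPow (s + s')` carries the letter `s` to `s'`. The section of `node p` at `s` is the
    -- conjugator for the remaining words; its other section meets only the trivial entry.
    refine ⟨aPow (s + s') * node p, mul_mem (aPow_mem_Gt _) hp, fun q => ?_⟩
    rw [atVertex, wreath_conj_node, atVertex]
    congr 1
    ext1 t
    by_cases ht : t = s'
    · subst ht
      have : t + (s + t) = s := by rw [add_left_comm, zmod_two_add_self, add_zero]
      simp only [this, Pi.mulSingle_eq_same, H]
    · have : t + (s + s') ≠ s := by
        intro h
        apply ht
        rw [add_left_comm, add_eq_left] at h
        rw [← CharTwo.sub_eq_add] at h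
        exact sub_eq_zero.1 h
      simp [Pi.mulSingle_eq_of_ne this, Pi.mulSingle_eq_of_ne ht]

/-- One vertex suffices: `G̃` is transitive on each level, and conjugation there realises every
conjugate of `q`. -/
lemma level_conjClosure_le {S : Set (Equiv.Perm Word)} {H : Subgroup (Equiv.Perm Word)}
    (hH : NormBy Gt H) (w : Word) (h : ∀ q ∈ S, atVertex q w ∈ H) :
    level (conjClosure Gt S) w.length ≤ H := by
  apply level_closure_le
  rintro _ ⟨g, hg, q, hq, rfl⟩ w' hw'
  obtain ⟨k, hk, hk'⟩ := exists_conj_atVertex hw'.symm hg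
  rw [← hk']
  exact hH k hk _ (h q hq)

/-- By self-replication every `g ∈ G̃` is the section at `s` of some `node p ∈ G̃`, and conjugating
by `node p` conjugates the entry at `s` by `g`. -/
lemma normBy_comap_nodeSingle {H : Subgroup (Equiv.Perm Word)} (hH : NormBy Gt H) (s : ZMod 2) :
    NormBy Gt (H.comap (nodeSingle s)) := by
  intro g hg q hq
  obtain ⟨p, rfl, hp⟩ := exists_node_mem_Gt s hg
  have : nodeSingle s (p s * q * (p s)⁻¹) = node p * nodeSingle s q * (node p)⁻¹ := by
    rw [nodeSingle_apply, nodeSingle_apply, ← map_inv, ← map_mul, ← map_mul]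
    congr 1
    ext1 t
    by_cases ht : t = s
    · subst ht; simp
    · simp [Pi.mulSingle_eq_of_ne ht]
  rw [Subgroup.mem_comap, this]
  exact hH _ hp _ hq

/-! ### Relations between the generators -/

lemma bcdFun_comm (w : Word) :
    bFun (cFun w) = cFun (bFun w) ∧ bFun (dFun w) = dFun (bFun w) ∧
      cFun (dFun w) = dFun (cFun w) := by
  induction w with
  | nil => simp [bFun, cFun, dFun]
  | cons s w ih =>
    by_cases hs : s = 0
    · simp [bFun, cFun, dFun, hs]
    · simp [bFun, cFun, dFun, hs, ih]

lemma b_mul_c : b * c = c * b := by ext1 w; exact (bcdFun_comm w).1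
lemma b_mul_d : b * d = d * b := by ext1 w; exact (bcdFun_comm w).2.1
lemma c_mul_d : c * d = d * c := by ext1 w; exact (bcdFun_comm w).2.2

lemma b_mul_b_mul (g : Equiv.Perm Word) : b * (b * g) = g := by
  rw [← mul_assoc, b_mul_b, one_mul]
lemma c_mul_c_mul (g : Equiv.Perm Word) : c * (c * g) = g := by
  rw [← mul_assoc, c_mul_c, one_mul]

/-- `z = [a, c̃]`. -/
def z : Equiv.Perm Word := ⁅a, c⁆

lemma x_eq : x = node (pair (c * a) (a * c)) := by
  rw [x, commutatorElement_def, a_inv, b_inv]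
  conv_lhs => rw [b_eq]
  rw [a_conj_node_pair, node_pair_mul]

lemma y_eq : y = node (pair b b) := by
  rw [y, commutatorElement_def, a_inv, d_inv]
  conv_lhs => rw [d_eq]
  rw [a_conj_node_pair, node_pair_mul, one_mul, mul_one]

lemma z_eq : z = node (pair d d) := by
  rw [z, commutatorElement_def, a_inv, c_inv]
  conv_lhs => rw [c_eq]
  rw [a_conj_node_pair, node_pair_mul, one_mul, mul_one]

lemma y_mul_y : y * y = 1 := by
  rw [y_eq, node_pair_mul, b_mul_b, pair_one_one, map_one]

lemma z_mul_z : z * z = 1 := by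
  rw [z_eq, node_pair_mul, d_mul_d, pair_one_one, map_one]

lemma y_mul_z : y * z = z * y := by
  rw [z_eq, y_eq, node_pair_mul, node_pair_mul, b_mul_d]

/-- `(ac)² = z`, and `(ca)²` is its inverse, which is `z` again. This identity explains the third
summand: `x²` records the class of `z` simultaneously in both subtrees. -/
lemma x_sq : x ^ 2 = node (pair z z) := by
  have h1 : a * c * (a * c) = z := by
    rw [z, commutatorElement_def, a_inv, c_inv]; simp only [mul_assoc]
  have h2 : c * a * (c * a) = z := by
    rw [← inv_eq_of_mul_eq_one_left z_mul_z, ← h1]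
    simp only [mul_inv_rev, a_inv, c_inv]
  rw [pow_two, x_eq, node_pair_mul, h1, h2]

lemma x_pow_four : x ^ 4 = 1 := by
  rw [show 4 = 2 * 2 from rfl, pow_mul, x_sq, pow_two, node_pair_mul, z_mul_z, pair_one_one,
    map_one]

lemma x_inv : x⁻¹ = x ^ 3 := by
  rw [inv_eq_iff_mul_eq_one, ← pow_succ', x_pow_four]

lemma commutator_x_a : ⁅x, a⁆ = x ^ 2 := by
  simp only [x, commutatorElement_def, mul_inv_rev, a_inv, b_inv, mul_assoc, pow_two, a_mul_a,
    mul_one]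

lemma commutator_x_b : ⁅x, b⁆ = x ^ 2 := by
  simp only [x, commutatorElement_def, mul_inv_rev, a_inv, b_inv, mul_assoc, pow_two, b_mul_b_mul]

lemma commutator_x_c : ⁅x, c⁆ = node (pair 1 y) := by
  have h : ⁅a * c, d⁆ = y := by
    simp only [y, commutatorElement_def, mul_inv_rev, a_inv, c_inv, d_inv, mul_assoc]
    rw [← mul_assoc c d, c_mul_d, mul_assoc, c_mul_c_mul]
  conv_lhs => rw [x_eq, c_eq, commutator_node_pair, ← c_eq, h, commutatorElement_one_right]

lemma commutator_x_d : ⁅x, d⁆ = node (pair 1 x) := by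
  have h : ⁅a * c, b⁆ = x := by
    simp only [x, commutatorElement_def, mul_inv_rev, a_inv, c_inv, b_inv, mul_assoc]
    rw [← mul_assoc c b, ← b_mul_c, mul_assoc, c_mul_c_mul]
  conv_lhs => rw [x_eq, d_eq, commutator_node_pair, h, commutatorElement_one_right]

lemma commutator_node_pair_a (g : Equiv.Perm Word) : ⁅node (pair g g), a⁆ = 1 := by
  rw [commutatorElement_def, a_inv, node_pair_inv, mul_assoc, mul_assoc, ← mul_assoc a,
    a_conj_node_pair, node_pair_mul, mul_inv_cancel, pair_one_one, map_one]

lemma commutator_y_b : ⁅y, b⁆ = node (pair x⁻¹ 1) := by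
  have h : ⁅b, c⁆ = 1 := commutatorElement_eq_one_iff_mul_comm.2 b_mul_c
  conv_lhs => rw [y_eq, b_eq, commutator_node_pair, ← b_eq, h, ← commutatorElement_inv, ← x]

lemma commutator_y_c : ⁅y, c⁆ = 1 := by
  have h : ⁅b, d⁆ = 1 := commutatorElement_eq_one_iff_mul_comm.2 b_mul_d
  rw [y_eq, c_eq, commutator_node_pair, h, commutatorElement_one_right, pair_one_one, map_one]

lemma commutator_y_d : ⁅y, d⁆ = 1 := by
  rw [y_eq, d_eq, commutator_node_pair, commutatorElement_self, commutatorElement_one_right,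
    pair_one_one, map_one]

lemma commutator_z_b : ⁅z, b⁆ = node (pair y⁻¹ 1) := by
  have h : ⁅d, c⁆ = 1 := commutatorElement_eq_one_iff_mul_comm.2 c_mul_d.symm
  rw [z_eq, b_eq, commutator_node_pair, h, ← commutatorElement_inv, ← y]

lemma commutator_z_c : ⁅z, c⁆ = 1 := by
  rw [z_eq, c_eq, commutator_node_pair, commutatorElement_self, commutatorElement_one_right,
    pair_one_one, map_one]

lemma commutator_z_d : ⁅z, d⁆ = 1 := by
  have h : ⁅d, b⁆ = 1 := commutatorElement_eq_one_iff_mul_comm.2 b_mul_d.symm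
  conv_lhs => rw [z_eq, d_eq, commutator_node_pair, ← d_eq, h, commutatorElement_one_right,
    pair_one_one, map_one]

/-! ### The first three terms of the lower central series -/

lemma lcs_succ {P : Type*} [Group P] (G : Subgroup P) {n : ℕ} (hn : 1 ≤ n) :
    lcs G (n + 1) = ⁅lcs G n, G⁆ := by
  obtain ⟨n, rfl⟩ := Nat.exists_eq_add_of_le' hn
  rfl

lemma lcs_one {P : Type*} [Group P] (G : Subgroup P) : lcs G 1 = G := rfl

lemma lcs_two {P : Type*} [Group P] (G : Subgroup P) : lcs G 2 = ⁅G, G⁆ := rfl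

lemma normBy_lcs {P : Type*} [Group P] (G : Subgroup P) (n : ℕ) : NormBy G (lcs G n) := by
  rw [lcs]
  induction n - 1 with
  | zero => exact normBy_self G
  | succ k ih => exact ih.commutator

lemma lcs_two_le : lcs Gt 2 ≤ Gt := (normBy_self Gt).commutator_le

lemma x_mem_lcs_two : x ∈ lcs Gt 2 := Subgroup.commutator_mem_commutator a_mem_Gt b_mem_Gt
lemma y_mem_lcs_two : y ∈ lcs Gt 2 := Subgroup.commutator_mem_commutator a_mem_Gt d_mem_Gt
lemma z_mem_lcs_two : z ∈ lcs Gt 2 := Subgroup.commutator_mem_commutator a_mem_Gt c_mem_Gt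

lemma x_mem_Kt : x ∈ Kt := subset_conjClosure _ (by simp)
lemma y_mem_Kt : y ∈ Kt := subset_conjClosure _ (by simp)
lemma x_sq_mem_Tt : x ^ 2 ∈ Tt := subset_conjClosure _ (by simp)

lemma Kt_le : Kt ≤ lcs Gt 2 := by
  apply conjClosure_le (normBy_lcs Gt 2)
  rintro _ (rfl | rfl)
  exacts [x_mem_lcs_two, y_mem_lcs_two]

lemma normBy_Nt (m : ℕ) : NormBy Gt (Nt m) :=
  ((normBy_conjClosure _ _).level _).sup ((normBy_conjClosure _ _).level _)

lemma Nt_succ_eq (m : ℕ) : Nt (m + 1) = level (Nt 1) m := by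
  rw [Nt, Nt, level_sup, level_level_one]
  rfl

/-- Three tuples normally generate the whole subgroup: `x` and `y` at one vertex, and `x²` at one
vertex of the level above. -/
lemma Nt_succ_le {H : Subgroup (Equiv.Perm Word)} (hH : NormBy Gt H) {w w' : Word}
    (hw : w.length = w'.length + 1) (hx : atVertex x w ∈ H) (hy : atVertex y w ∈ H)
    (hxx : atVertex (x ^ 2) w' ∈ H) : Nt (w'.length + 1) ≤ H := by
  rw [Nt, ← hw, hw, Nat.add_sub_cancel, ← hw]
  refine sup_le (level_conjClosure_le hH w ?_) (level_conjClosure_le hH w' ?_)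
  · rintro _ (rfl | rfl) <;> assumption
  · rintro _ rfl
    exact hxx

lemma x_sq_mem_Nt_one : x ^ 2 ∈ Nt 1 := Subgroup.mem_sup_right x_sq_mem_Tt

lemma node_pair_mem_Nt_one {g h : Equiv.Perm Word} (hg : g ∈ Kt) (hh : h ∈ Kt) :
    node (pair g h) ∈ Nt 1 :=
  Subgroup.mem_sup_left (node_pair_mem_level_succ.2 ⟨hg, hh⟩)

/-- The three normal generators are commutators of `x ∈ γ₂`: `(1, x) = [x, d]`, `(1, y) = [x, c]`,
`x² = [x, a]`. -/
lemma Nt_one_le_lcs_three : Nt 1 ≤ lcs Gt 3 := by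
  apply Nt_succ_le (normBy_lcs Gt 3) (w := [1]) (w' := []) rfl
  · rw [atVertex, mulSingle_one_eq_pair, atVertex, ← commutator_x_d]
    exact Subgroup.commutator_mem_commutator x_mem_lcs_two d_mem_Gt
  · rw [atVertex, mulSingle_one_eq_pair, atVertex, ← commutator_x_c]
    exact Subgroup.commutator_mem_commutator x_mem_lcs_two c_mem_Gt
  · rw [atVertex, ← commutator_x_a]
    exact Subgroup.commutator_mem_commutator x_mem_lcs_two a_mem_Gt

/-- The table of twelve commutators: each is trivial, equal to `x²`, or a pair with one trivial
entry and the other in `Kt`. -/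
lemma commutator_xyz_mem {s t : Equiv.Perm Word} (hs : s = x ∨ s = y ∨ s = z)
    (ht : t ∈ ({a, b, c, d} : Set (Equiv.Perm Word))) : ⁅s, t⁆ ∈ Nt 1 := by
  have hya : ⁅y, a⁆ = 1 := by rw [y_eq, commutator_node_pair_a]
  have hza : ⁅z, a⁆ = 1 := by rw [z_eq, commutator_node_pair_a]
  rcases hs with rfl | rfl | rfl <;> rcases ht with rfl | rfl | rfl | rfl
  · rw [commutator_x_a]; exact x_sq_mem_Nt_one
  · rw [commutator_x_b]; exact x_sq_mem_Nt_one
  · rw [commutator_x_c]; exact node_pair_mem_Nt_one (one_mem _) y_mem_Kt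
  · rw [commutator_x_d]; exact node_pair_mem_Nt_one (one_mem _) x_mem_Kt
  · rw [hya]; exact one_mem _
  · rw [commutator_y_b]; exact node_pair_mem_Nt_one (inv_mem x_mem_Kt) (one_mem _)
  · rw [commutator_y_c]; exact one_mem _
  · rw [commutator_y_d]; exact one_mem _
  · rw [hza]; exact one_mem _
  · rw [commutator_z_b]; exact node_pair_mem_Nt_one (inv_mem y_mem_Kt) (one_mem _)
  · rw [commutator_z_c]; exact one_mem _
  · rw [commutator_z_d]; exact one_mem _

/-- `γ₂(G̃)` is generated by `x`, `y`, `z` modulo `Ñ₁`, and central modulo `Ñ₁`. -/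
lemma lcs_two_le_closure_and_commutator_le :
    lcs Gt 2 ≤ Subgroup.closure (Nt 1 ∪ {x, y, z}) ∧ lcs Gt 3 ≤ Nt 1 := by
  have hN : Nt 1 ≤ Gt := Nt_one_le_lcs_three.trans
    ((normBy_lcs Gt 2).commutator_le.trans lcs_two_le)
  have hM : Subgroup.closure (Nt 1 ∪ {x, y, z}) ≤ Gt := by
    rw [Subgroup.closure_le]
    rintro g (hg | rfl | rfl | rfl)
    exacts [hN hg, lcs_two_le x_mem_lcs_two, lcs_two_le y_mem_lcs_two, lcs_two_le z_mem_lcs_two]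
  have hNM : Nt 1 ≤ Subgroup.closure (Nt 1 ∪ {x, y, z}) := fun g hg =>
    Subgroup.subset_closure (Or.inl hg)
  have hcomm : ⁅Subgroup.closure (Nt 1 ∪ {x, y, z}), Gt⁆ ≤ Nt 1 := by
    apply commutator_closure_le (fun g hg => normBy_Nt 1 g (hM hg)) (normBy_Nt 1)
    rintro s (hs | hs) t ht
    · exact (normBy_Nt 1).commutator_le
        (Subgroup.commutator_mem_commutator hs (Subgroup.subset_closure ht))
    · exact commutator_xyz_mem hs ht
  -- Normality comes from centrality modulo `Nt 1`: `g q g⁻¹ = [q, g]⁻¹ q`.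
  have hnorm : NormBy Gt (Subgroup.closure (Nt 1 ∪ {x, y, z})) := by
    intro g hg q hq
    have h := mul_mem (hNM (inv_mem (hcomm (Subgroup.commutator_mem_commutator hq hg)))) hq
    rwa [commutatorElement_inv, commutatorElement_def, inv_mul_cancel_right] at h
  have h2 : lcs Gt 2 ≤ Subgroup.closure (Nt 1 ∪ {x, y, z}) := by
    apply commutator_closure_le hnorm hnorm
    have hx : x ∈ Subgroup.closure (Nt 1 ∪ {x, y, z}) := Subgroup.subset_closure (by simp)
    have hy : y ∈ Subgroup.closure (Nt 1 ∪ {x, y, z}) := Subgroup.subset_closure (by simp)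
    have hz : z ∈ Subgroup.closure (Nt 1 ∪ {x, y, z}) := Subgroup.subset_closure (by simp)
    have hone : ∀ {g h : Equiv.Perm Word}, g * h = h * g →
        ⁅g, h⁆ ∈ Subgroup.closure (Nt 1 ∪ {x, y, z}) := by
      intro g h hgh
      rw [commutatorElement_eq_one_iff_mul_comm.2 hgh]
      exact one_mem _
    have hinv : ∀ {g h : Equiv.Perm Word}, ⁅g, h⁆ ∈ Subgroup.closure (Nt 1 ∪ {x, y, z}) →
        ⁅h, g⁆ ∈ Subgroup.closure (Nt 1 ∪ {x, y, z}) := by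
      intro g h hgh
      rw [← commutatorElement_inv]
      exact inv_mem hgh
    -- Since `b`, `c`, `d` commute with each other, the only commutators of generators that remain
    -- are those with `a`, namely `x`, `z`, `y` and their inverses.
    rintro s (rfl | rfl | rfl | rfl) t (rfl | rfl | rfl | rfl)
    exacts [hone rfl, hx, hz, hy, hinv hx, hone rfl, hone b_mul_c, hone b_mul_d,
      hinv hz, hone b_mul_c.symm, hone rfl, hone c_mul_d,
      hinv hy, hone b_mul_d.symm, hone c_mul_d.symm, hone rfl]
  exact ⟨h2, (Subgroup.commutator_mono h2 le_rfl).trans hcomm⟩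

lemma lcs_three_eq : lcs Gt 3 = Nt 1 :=
  le_antisymm lcs_two_le_closure_and_commutator_le.2 Nt_one_le_lcs_three

lemma Nt_one_le_lcs_two : Nt 1 ≤ lcs Gt 2 :=
  Nt_one_le_lcs_three.trans (normBy_lcs Gt 2).commutator_le

/-- Moving an element past another one, modulo the commutators. -/
lemma exists_mul_comm_mod {P : Type*} [Group P] {N : Subgroup P} {g h n : P}
    (hc : ⁅g⁻¹, h⁻¹⁆ ∈ N) (hn : n ∈ N) : ∃ n' ∈ N, g * (h * n) = h * g * n' :=
  ⟨_, mul_mem hc hn, by simp only [commutatorElement_def]; group⟩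

/-- The quotient of `γ₂` by `Nt 1 = γ₃` is abelian and generated by `x`, `y`, `z`; the commutators
created by sorting a product are absorbed into the factor from `Nt 1`. -/
lemma exists_eq_of_mem_lcs_two {g : Equiv.Perm Word} (hg : g ∈ lcs Gt 2) :
    ∃ i j k : ℕ, ∃ n ∈ Nt 1, g = x ^ i * y ^ j * z ^ k * n := by
  have hcomm : ∀ {s t : Equiv.Perm Word}, s ∈ lcs Gt 2 → t ∈ Gt → ⁅s⁻¹, t⁻¹⁆ ∈ Nt 1 := by
    intro s t hs ht
    rw [← lcs_three_eq]
    exact Subgroup.commutator_mem_commutator (inv_mem hs) (inv_mem ht)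
  have hmem : ∀ i j k : ℕ, x ^ i * y ^ j * z ^ k ∈ Gt := fun i j k => lcs_two_le
    (mul_mem (mul_mem (pow_mem x_mem_lcs_two _) (pow_mem y_mem_lcs_two _))
      (pow_mem z_mem_lcs_two _))
  have key : ∀ s, s ∈ (Nt 1 ∪ {x, y, z} : Set (Equiv.Perm Word)) → ∀ g,
      (∃ i j k : ℕ, ∃ n ∈ Nt 1, g = x ^ i * y ^ j * z ^ k * n) →
      ∃ i j k : ℕ, ∃ n ∈ Nt 1, s * g = x ^ i * y ^ j * z ^ k * n := by
    rintro s hs _ ⟨i, j, k, n, hn, rfl⟩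
    rcases hs with hs | rfl | rfl | rfl
    · obtain ⟨n', hn', h⟩ := exists_mul_comm_mod (hcomm (Nt_one_le_lcs_two hs) (hmem i j k)) hn
      exact ⟨i, j, k, s * n', mul_mem hs hn', by rw [h, mul_assoc]⟩
    · exact ⟨i + 1, j, k, n, hn, by simp only [pow_succ', mul_assoc]⟩
    · obtain ⟨n', hn', h⟩ := exists_mul_comm_mod (hcomm y_mem_lcs_two (hmem i j k)) hn
      refine ⟨i, j + 1, k, n', hn', ?_⟩
      rw [h, pow_succ y, mul_assoc _ (z ^ k), ← (Commute.pow_right y_mul_z k).eq]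
      simp only [mul_assoc]
    · obtain ⟨n', hn', h⟩ := exists_mul_comm_mod (hcomm z_mem_lcs_two (hmem i j k)) hn
      exact ⟨i, j, k + 1, n', hn', by rw [h, pow_succ z]; simp only [mul_assoc]⟩
  have h := lcs_two_le_closure_and_commutator_le.1 hg
  clear hg
  induction h using Subgroup.closure_induction_left with
  | one => exact ⟨0, 0, 0, 1, one_mem _, by simp⟩
  | mul_left s hs g _ ih => exact key s hs g ih
  | inv_mul_cancel s hs g _ ih =>
    -- For `s = x` the inverse is `x³`, so it is handled by three multiplications by `x`; the other
    -- generators `y` and `z` are involutions.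
    have h3 := key s hs _ (key s hs _ (key s hs g ih))
    rcases hs with hs | rfl | rfl | rfl
    · exact key _ (Or.inl (inv_mem hs)) g ih
    · rw [x_inv]
      simpa only [pow_succ, pow_zero, one_mul, mul_assoc] using h3
    · rw [inv_eq_of_mul_eq_one_left y_mul_y]
      exact key _ (by simp) g ih
    · rw [inv_eq_of_mul_eq_one_left z_mul_z]
      exact key _ (by simp) g ih

lemma exists_eq_of_mem_Gt {g : Equiv.Perm Word} (hg : g ∈ Gt) :
    ∃ i j k l : ℕ, ∃ n ∈ lcs Gt 2, g = a ^ i * b ^ j * c ^ k * d ^ l * n := by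
  have hcomm : ∀ {s t : Equiv.Perm Word}, s ∈ Gt → t ∈ Gt → ⁅s⁻¹, t⁻¹⁆ ∈ lcs Gt 2 :=
    fun hs ht => Subgroup.commutator_mem_commutator (inv_mem hs) (inv_mem ht)
  have hmem : ∀ i j k l : ℕ, a ^ i * b ^ j * c ^ k * d ^ l ∈ Gt := fun i j k l =>
    mul_mem (mul_mem (mul_mem (pow_mem a_mem_Gt _) (pow_mem b_mem_Gt _)) (pow_mem c_mem_Gt _))
      (pow_mem d_mem_Gt _)
  have key : ∀ s, s ∈ ({a, b, c, d} : Set (Equiv.Perm Word)) → ∀ g,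
      (∃ i j k l : ℕ, ∃ n ∈ lcs Gt 2, g = a ^ i * b ^ j * c ^ k * d ^ l * n) →
      ∃ i j k l : ℕ, ∃ n ∈ lcs Gt 2, s * g = a ^ i * b ^ j * c ^ k * d ^ l * n := by
    rintro s hs _ ⟨i, j, k, l, n, hn, rfl⟩
    rcases hs with rfl | rfl | rfl | rfl
    · exact ⟨i + 1, j, k, l, n, hn, by simp only [pow_succ', mul_assoc]⟩
    · obtain ⟨n', hn', h⟩ := exists_mul_comm_mod (hcomm b_mem_Gt (hmem i j k l)) hn
      refine ⟨i, j + 1, k, l, n', hn', ?_⟩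
      rw [h, pow_succ b, mul_assoc _ (d ^ l), ← (Commute.pow_right b_mul_d l).eq,
        mul_assoc _ (c ^ k), ← mul_assoc (c ^ k), ← (Commute.pow_right b_mul_c k).eq]
      simp only [mul_assoc]
    · obtain ⟨n', hn', h⟩ := exists_mul_comm_mod (hcomm c_mem_Gt (hmem i j k l)) hn
      refine ⟨i, j, k + 1, l, n', hn', ?_⟩
      rw [h, pow_succ c, mul_assoc _ (d ^ l), ← (Commute.pow_right c_mul_d l).eq]
      simp only [mul_assoc]
    · obtain ⟨n', hn', h⟩ := exists_mul_comm_mod (hcomm d_mem_Gt (hmem i j k l)) hn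
      exact ⟨i, j, k, l + 1, n', hn', by rw [h, pow_succ d]; simp only [mul_assoc]⟩
  induction hg using Subgroup.closure_induction_left with
  | one => exact ⟨0, 0, 0, 0, 1, one_mem _, by simp⟩
  | mul_left s hs g _ ih => exact key s hs g ih
  | inv_mul_cancel s hs g _ ih =>
    have : s⁻¹ = s := by
      rcases hs with rfl | rfl | rfl | rfl
      exacts [a_inv, b_inv, c_inv, d_inv]
    rw [this]
    exact key s hs g ih

/-! ### Homomorphisms to `𝔽₂` -/

/-- The restriction of `f` to `Q` is a homomorphism. -/
def IsHomOn (f : Equiv.Perm Word → ZMod 2) (Q : Subgroup (Equiv.Perm Word)) : Prop :=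
  ∀ g ∈ Q, ∀ h ∈ Q, f (g * h) = f g + f h

namespace IsHomOn

variable {f : Equiv.Perm Word → ZMod 2} {Q R : Subgroup (Equiv.Perm Word)}

lemma map_one (hf : IsHomOn f Q) : f 1 = 0 := by
  have h := hf 1 (one_mem _) 1 (one_mem _)
  simpa using h

lemma map_inv (hf : IsHomOn f Q) {g : Equiv.Perm Word} (hg : g ∈ Q) : f g⁻¹ = f g := by
  have h := hf g hg _ (inv_mem hg)
  rw [mul_inv_cancel, hf.map_one] at h
  rw [eq_comm, ← sub_eq_zero, CharTwo.sub_eq_add, h]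

lemma map_pow (hf : IsHomOn f Q) {g : Equiv.Perm Word} (hg : g ∈ Q) (n : ℕ) :
    f (g ^ n) = n * f g := by
  induction n with
  | zero => simpa using hf.map_one
  | succ n ih =>
    rw [pow_succ, hf _ (pow_mem hg n) _ hg, ih]
    push_cast
    ring

lemma map_conj (hf : IsHomOn f Q) {g h : Equiv.Perm Word} (hg : g ∈ Q) (hh : h ∈ Q) :
    f (g * h * g⁻¹) = f h := by
  rw [hf _ (mul_mem hg hh) _ (inv_mem hg), hf _ hg _ hh, hf.map_inv hg, add_right_comm,
    zmod_two_add_self, zero_add]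

/-- The kernel of the restriction of `f` to `Q`. -/
def ker (hf : IsHomOn f Q) : Subgroup (Equiv.Perm Word) where
  carrier := {g | g ∈ Q ∧ f g = 0}
  one_mem' := ⟨one_mem _, hf.map_one⟩
  mul_mem' := by
    rintro g h ⟨hg, hg'⟩ ⟨hh, hh'⟩
    exact ⟨mul_mem hg hh, by rw [hf _ hg _ hh, hg', hh', add_zero]⟩
  inv_mem' := by
    rintro g ⟨hg, hg'⟩
    exact ⟨inv_mem hg, by rw [hf.map_inv hg, hg']⟩

end IsHomOn

/-- The number of vertices of level `n` at which the portrait of `g` is non-trivial, modulo 2. -/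
def sgn : ℕ → Equiv.Perm Word → ZMod 2
  | 0, g => root g
  | n + 1, g => sgn n (sec g 0) + sgn n (sec g 1)

/-- In a product the right factor may swap the two sections of the left one, but the sum over both
subtrees does not see the swap. -/
lemma sgn_isHomOn (n : ℕ) : IsHomOn (sgn n) Gt := by
  induction n with
  | zero => exact fun g hg h hh => root_mul hg hh
  | succ n ih =>
    intro g hg h hh
    simp only [sgn]
    rw [sec_mul hg hh, sec_mul hg hh, ih _ (sec_mem_Gt hg _) _ (sec_mem_Gt hh _),
      ih _ (sec_mem_Gt hg _) _ (sec_mem_Gt hh _)]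
    rcases zmod_two_cases (root h) with h0 | h0
    · rw [h0, add_zero, add_zero]; ring
    · rw [h0, zero_add, zmod_two_add_self]; ring

lemma sgn_succ_a (n : ℕ) : sgn (n + 1) a = 0 := by
  rw [sgn, sec_a, Pi.one_apply, Pi.one_apply, zmod_two_add_self]

lemma sgn_succ_node_pair (n : ℕ) (g h : Equiv.Perm Word) :
    sgn (n + 1) (node (pair g h)) = sgn n g + sgn n h := by
  rw [sgn, sec_node, pair_zero, pair_one]

lemma sgn_succ_b (n : ℕ) : sgn (n + 1) b = sgn n a + sgn n c := by
  rw [b_eq, sgn_succ_node_pair]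

lemma sgn_succ_c (n : ℕ) : sgn (n + 1) c = sgn n d := by
  conv_lhs => rw [c_eq]
  rw [sgn_succ_node_pair, (sgn_isHomOn n).map_one, zero_add]

lemma sgn_succ_d (n : ℕ) : sgn (n + 1) d = sgn n b := by
  conv_lhs => rw [d_eq]
  rw [sgn_succ_node_pair, (sgn_isHomOn n).map_one, zero_add]

lemma sgn_zero_a : sgn 0 a = 1 := root_a
lemma sgn_zero_b : sgn 0 b = 0 := by rw [b_eq]; exact root_node _
lemma sgn_zero_c : sgn 0 c = 0 := by rw [c_eq]; exact root_node _
lemma sgn_zero_d : sgn 0 d = 0 := by rw [d_eq]; exact root_node _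

lemma sgn_eq_zero_of_mem_lcs_two (n : ℕ) {g : Equiv.Perm Word} (hg : g ∈ lcs Gt 2) :
    sgn n g = 0 := by
  have h : lcs Gt 2 ≤ (sgn_isHomOn n).ker := by
    rw [lcs_two, Subgroup.commutator_le]
    intro g hg h hh
    refine ⟨lcs_two_le (Subgroup.commutator_mem_commutator hg hh), ?_⟩
    rw [commutatorElement_def, sgn_isHomOn n _ (mul_mem (mul_mem hg hh) (inv_mem hg)) _
      (inv_mem hh), (sgn_isHomOn n).map_conj hg hh, (sgn_isHomOn n).map_inv hh,
      zmod_two_add_self]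
  exact (h hg).2

lemma sgn_abcd {i j k l : ℕ} {n : Equiv.Perm Word} (hn : n ∈ lcs Gt 2) (m : ℕ) :
    sgn m (a ^ i * b ^ j * c ^ k * d ^ l * n) =
      i * sgn m a + j * sgn m b + k * sgn m c + l * sgn m d := by
  have h := sgn_isHomOn m
  have ha := pow_mem a_mem_Gt i
  have hb := pow_mem b_mem_Gt j
  have hc := pow_mem c_mem_Gt k
  have hd := pow_mem d_mem_Gt l
  rw [h _ (mul_mem (mul_mem (mul_mem ha hb) hc) hd) _ (lcs_two_le hn),
    h _ (mul_mem (mul_mem ha hb) hc) _ hd, h _ (mul_mem ha hb) _ hc, h _ ha _ hb,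
    h.map_pow a_mem_Gt, h.map_pow b_mem_Gt, h.map_pow c_mem_Gt, h.map_pow d_mem_Gt,
    sgn_eq_zero_of_mem_lcs_two m hn, add_zero]

lemma pow_mem_of_natCast_eq_zero {P : Type*} [Group P] {N : Subgroup P} {g : P}
    (hg : g ^ 2 ∈ N) {i : ℕ} (hi : (i : ZMod 2) = 0) : g ^ i ∈ N := by
  obtain ⟨k, rfl⟩ := (ZMod.natCast_eq_zero_iff i 2).1 hi
  rw [pow_mul]
  exact pow_mem hg k

/-- The characters of `G̃` detect `γ₂(G̃)`. -/
lemma mem_lcs_two_of_sgn_eq_zero {g : Equiv.Perm Word} (hg : g ∈ Gt)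
    (h : ∀ m < 4, sgn m g = 0) : g ∈ lcs Gt 2 := by
  obtain ⟨i, j, k, l, n, hn, rfl⟩ := exists_eq_of_mem_Gt hg
  have h0 := h 0 (by norm_num)
  have h1 := h 1 (by norm_num)
  have h2 := h 2 (by norm_num)
  have h3 := h 3 (by norm_num)
  rw [sgn_abcd hn] at h0 h1 h2 h3
  -- On `a, b, d, c`, in this order, `sgn 0, …, sgn 3` form the identity matrix. So `h2` gives the
  -- exponent of `d` and `h3` that of `c`.
  simp only [sgn_succ_a, sgn_succ_b, sgn_succ_c, sgn_succ_d, sgn_zero_a, sgn_zero_b, sgn_zero_c,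
    sgn_zero_d, mul_zero, mul_one, add_zero, zero_add] at h0 h1 h2 h3
  refine mul_mem (mul_mem (mul_mem (mul_mem ?_ ?_) ?_) ?_) hn
  · exact pow_mem_of_natCast_eq_zero (by rw [pow_two, a_mul_a]; exact one_mem _) h0
  · exact pow_mem_of_natCast_eq_zero (by rw [pow_two, b_mul_b]; exact one_mem _) h1
  · exact pow_mem_of_natCast_eq_zero (by rw [pow_two, c_mul_c]; exact one_mem _) h3
  · exact pow_mem_of_natCast_eq_zero (by rw [pow_two, d_mul_d]; exact one_mem _) h2

/-- The characters of `γ₂(G̃)` given by those of `G̃` on the two (equivalent) halves. -/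
def psi (n : ℕ) (g : Equiv.Perm Word) : ZMod 2 := sgn n (sec g 0)

lemma root_eq_zero_of_mem_lcs_two {g : Equiv.Perm Word} (hg : g ∈ lcs Gt 2) : root g = 0 :=
  sgn_eq_zero_of_mem_lcs_two 0 hg

/-- `sgn (n + 1)` is the sum of the two sectional values and vanishes on `γ₂`, so these values
agree. Hence `psi` is independent of the chosen letter. -/
lemma sgn_sec_of_mem_lcs_two {g : Equiv.Perm Word} (hg : g ∈ lcs Gt 2) (n : ℕ) (s : ZMod 2) :
    sgn n (sec g s) = psi n g := by
  rcases zmod_two_cases s with rfl | rfl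
  · rfl
  · have h := sgn_eq_zero_of_mem_lcs_two (n + 1) hg
    rw [sgn, ← CharTwo.sub_eq_add, sub_eq_zero] at h
    exact h.symm

lemma psi_isHomOn (n : ℕ) : IsHomOn (psi n) (lcs Gt 2) := by
  intro g hg h hh
  have hg' := lcs_two_le hg
  have hh' := lcs_two_le hh
  rw [psi, sec_mul hg' hh', root_eq_zero_of_mem_lcs_two hh,
    sgn_isHomOn n _ (sec_mem_Gt hg' _) _ (sec_mem_Gt hh' _), add_zero]
  rfl

/-- Conjugation may swap the sections, which have equal `sgn n`, and conjugates them inside `G̃`,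
where a character does not change. -/
lemma psi_conj (n : ℕ) {g h : Equiv.Perm Word} (hg : g ∈ Gt) (hh : h ∈ lcs Gt 2) :
    psi n (g * h * g⁻¹) = psi n h := by
  have hh' := lcs_two_le hh
  have hs := sgn_sec_of_mem_lcs_two hh n
  rw [eq_node_of_root_eq_zero hh' (root_eq_zero_of_mem_lcs_two hh), eq_wreath hg,
    wreath_conj_node, psi, sec_node,
    (sgn_isHomOn n).map_conj (sec_mem_Gt hg _) (sec_mem_Gt hh' _), hs, psi, psi, sec_node]

lemma psi_node_pair (n : ℕ) (g h : Equiv.Perm Word) : psi n (node (pair g h)) = sgn n g := by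
  rw [psi, sec_node, pair_zero]

lemma psi_x (n : ℕ) : psi n x = sgn n c + sgn n a := by
  rw [x_eq, psi_node_pair, sgn_isHomOn n _ c_mem_Gt _ a_mem_Gt]

lemma psi_y (n : ℕ) : psi n y = sgn n b := by
  rw [y_eq, psi_node_pair]

lemma psi_z (n : ℕ) : psi n z = sgn n d := by
  rw [z_eq, psi_node_pair]

lemma psi_x_values : psi 0 x = 1 ∧ psi 1 x = 0 ∧ psi 2 x = 0 := by
  simp [psi_x, sgn_succ_a, sgn_succ_c, sgn_succ_d, sgn_zero_a, sgn_zero_b, sgn_zero_c,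
    sgn_zero_d]

lemma psi_y_values : psi 0 y = 0 ∧ psi 1 y = 1 ∧ psi 2 y = 0 := by
  simp [psi_y, sgn_succ_a, sgn_succ_b, sgn_succ_c, sgn_zero_a, sgn_zero_b, sgn_zero_c,
    sgn_zero_d]

lemma psi_z_values : psi 0 z = 0 ∧ psi 1 z = 0 ∧ psi 2 z = 1 := by
  simp [psi_z, sgn_succ_b, sgn_succ_d, sgn_zero_a, sgn_zero_b, sgn_zero_c,
    sgn_zero_d]

lemma normBy_ker_psi (n : ℕ) : NormBy Gt (psi_isHomOn n).ker := by
  rintro g hg q ⟨hq, hq'⟩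
  exact ⟨normBy_lcs Gt 2 g hg q hq, by rw [psi_conj n hg hq, hq']⟩

lemma Kt_le_ker_psi_two : Kt ≤ (psi_isHomOn 2).ker := by
  apply conjClosure_le (normBy_ker_psi 2)
  rintro _ (rfl | rfl)
  exacts [⟨x_mem_lcs_two, psi_x_values.2.2⟩, ⟨y_mem_lcs_two, psi_y_values.2.2⟩]

/-- At the letter `0` the normal generators `(1, x)`, `(1, y)`, `x² = (z, z)` have sections `1`, `1`
and `z ∈ γ₂`, all killed by `sgn n`. -/
lemma Nt_one_le_ker_psi (n : ℕ) : Nt 1 ≤ (psi_isHomOn n).ker := by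
  have h1 : psi n (node (pair 1 x)) = 0 := by rw [psi_node_pair, (sgn_isHomOn n).map_one]
  have h2 : psi n (node (pair 1 y)) = 0 := by rw [psi_node_pair, (sgn_isHomOn n).map_one]
  have h3 : psi n (x ^ 2) = 0 := by
    rw [x_sq, psi_node_pair, sgn_eq_zero_of_mem_lcs_two n z_mem_lcs_two]
  apply Nt_succ_le (normBy_ker_psi n) (w := [1]) (w' := []) rfl
  · rw [atVertex, mulSingle_one_eq_pair]
    exact ⟨Nt_one_le_lcs_two (node_pair_mem_Nt_one (one_mem _) x_mem_Kt), h1⟩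
  · rw [atVertex, mulSingle_one_eq_pair]
    exact ⟨Nt_one_le_lcs_two (node_pair_mem_Nt_one (one_mem _) y_mem_Kt), h2⟩
  · exact ⟨Nt_one_le_lcs_two x_sq_mem_Nt_one, h3⟩

lemma psi_xyz {i j k : ℕ} {n : Equiv.Perm Word} (hn : n ∈ Nt 1) (m : ℕ) :
    psi m (x ^ i * y ^ j * z ^ k * n) = i * psi m x + j * psi m y + k * psi m z := by
  have h := psi_isHomOn m
  have hx := pow_mem x_mem_lcs_two i
  have hy := pow_mem y_mem_lcs_two j
  have hz := pow_mem z_mem_lcs_two k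
  rw [h _ (mul_mem (mul_mem hx hy) hz) _ (Nt_one_le_lcs_two hn), h _ (mul_mem hx hy) _ hz,
    h _ hx _ hy, h.map_pow x_mem_lcs_two, h.map_pow y_mem_lcs_two, h.map_pow z_mem_lcs_two,
    (Nt_one_le_ker_psi m hn).2, add_zero]

/-- The characters of `γ₂(G̃)` detect `Ñ₁`. -/
lemma mem_Nt_one_of_psi_eq_zero {g : Equiv.Perm Word} (hg : g ∈ lcs Gt 2)
    (h : ∀ m < 3, psi m g = 0) : g ∈ Nt 1 := by
  obtain ⟨i, j, k, n, hn, rfl⟩ := exists_eq_of_mem_lcs_two hg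
  have h0 := h 0 (by norm_num)
  have h1 := h 1 (by norm_num)
  have h2 := h 2 (by norm_num)
  obtain ⟨hx0, hx1, hx2⟩ := psi_x_values
  obtain ⟨hy0, hy1, hy2⟩ := psi_y_values
  obtain ⟨hz0, hz1, hz2⟩ := psi_z_values
  rw [psi_xyz hn] at h0 h1 h2
  simp only [hx0, hx1, hx2, hy0, hy1, hy2, hz0, hz1, hz2, mul_zero, mul_one, add_zero,
    zero_add] at h0 h1 h2
  refine mul_mem (mul_mem (mul_mem ?_ ?_) ?_) hn
  · exact pow_mem_of_natCast_eq_zero x_sq_mem_Nt_one h0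
  · exact pow_mem_of_natCast_eq_zero (by rw [pow_two, y_mul_y]; exact one_mem _) h1
  · exact pow_mem_of_natCast_eq_zero (by rw [pow_two, z_mul_z]; exact one_mem _) h2

/-- The character of `Ñ₁` which is non-trivial on `x²`. -/
def theta (g : Equiv.Perm Word) : ZMod 2 := psi 2 (sec g 0)

/-- An element of `Ñ₁` has sections in `γ₂(G̃)` with the same character `psi 2`. -/
lemma sec_of_mem_Nt_one {g : Equiv.Perm Word} (hg : g ∈ Nt 1) (s : ZMod 2) :
    sec g s ∈ lcs Gt 2 ∧ psi 2 (sec g s) = theta g := by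
  -- `E` consists of the pairs over `γ₂` whose entries have equal `psi 2`. It contains the pairs
  -- over `Kt`, where both values are zero, and `x² = (z, z)`; being stable under `G̃`, it contains
  -- `Nt 1`.
  let E : Subgroup (Equiv.Perm Word) :=
    { carrier := {g | g ∈ level (lcs Gt 2) 1 ∧ psi 2 (sec g 0) = psi 2 (sec g 1)}
      one_mem' := ⟨one_mem _, by rw [← map_one node, sec_node]; rfl⟩
      mul_mem' := by
        rintro _ _ ⟨h1, hp⟩ ⟨h2, hq⟩
        obtain ⟨p, hp', rfl⟩ := mem_level_succ.1 h1
        obtain ⟨q, hq', rfl⟩ := mem_level_succ.1 h2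
        refine ⟨mul_mem h1 h2, ?_⟩
        simp only [sec_node] at hp hq
        rw [← map_mul, sec_node, Pi.mul_apply, Pi.mul_apply,
          psi_isHomOn 2 _ (hp' 0) _ (hq' 0), psi_isHomOn 2 _ (hp' 1) _ (hq' 1), hp, hq]
      inv_mem' := by
        rintro _ ⟨h1, hp⟩
        obtain ⟨p, hp', rfl⟩ := mem_level_succ.1 h1
        refine ⟨inv_mem h1, ?_⟩
        simp only [sec_node] at hp
        rw [← map_inv, sec_node, Pi.inv_apply, Pi.inv_apply, (psi_isHomOn 2).map_inv (hp' 0),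
          (psi_isHomOn 2).map_inv (hp' 1), hp] }
  have hE : NormBy Gt E := by
    rintro g hg _ ⟨h1, hp⟩
    refine ⟨(normBy_lcs Gt 2).level 1 g hg _ h1, ?_⟩
    obtain ⟨p, hp', rfl⟩ := mem_level_succ.1 h1
    simp only [sec_node] at hp
    obtain ⟨i, q, hq, rfl⟩ := exists_wreath_of_mem_Gt hg
    rw [wreath_conj_node, sec_node, psi_conj 2 (hq _) (hp' _), psi_conj 2 (hq _) (hp' _)]
    rcases zmod_two_cases i with rfl | rfl
    · simpa using hp
    · simpa [zmod_two_add_self] using hp.symm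
  have hN : Nt 1 ≤ E := by
    apply sup_le
    · intro g hg
      refine ⟨level_mono Kt_le 1 hg, ?_⟩
      obtain ⟨p, hp, rfl⟩ := mem_level_succ.1 hg
      rw [sec_node, (Kt_le_ker_psi_two (hp 0)).2, (Kt_le_ker_psi_two (hp 1)).2]
    · apply conjClosure_le hE
      rintro _ rfl
      rw [x_sq]
      exact ⟨node_pair_mem_level_succ.2 ⟨z_mem_lcs_two, z_mem_lcs_two⟩, by rw [sec_node]; rfl⟩
  obtain ⟨h1, h2⟩ := hN hg
  obtain ⟨p, hp, rfl⟩ := mem_level_succ.1 h1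
  simp only [theta, sec_node] at h2 ⊢
  refine ⟨hp s, ?_⟩
  rcases zmod_two_cases s with rfl | rfl
  · rfl
  · exact h2.symm

lemma Nt_one_le_level : Nt 1 ≤ level (lcs Gt 2) 1 := by
  intro g hg
  have hg' := Nt_one_le_lcs_two hg
  rw [eq_node_of_root_eq_zero (lcs_two_le hg') (root_eq_zero_of_mem_lcs_two hg')]
  exact node_mem_level_succ.2 fun s => (sec_of_mem_Nt_one hg s).1

lemma theta_isHomOn : IsHomOn theta (Nt 1) := by
  intro g hg h hh
  have hg' := Nt_one_le_lcs_two hg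
  have hh' := Nt_one_le_lcs_two hh
  rw [theta, sec_mul (lcs_two_le hg') (lcs_two_le hh'), root_eq_zero_of_mem_lcs_two hh',
    psi_isHomOn 2 _ (sec_of_mem_Nt_one hg _).1 _ (sec_of_mem_Nt_one hh _).1, add_zero]
  rfl

lemma theta_conj {g h : Equiv.Perm Word} (hg : g ∈ Gt) (hh : h ∈ Nt 1) :
    theta (g * h * g⁻¹) = theta h := by
  have hh' := Nt_one_le_lcs_two hh
  have hs := fun s => sec_of_mem_Nt_one hh s
  rw [eq_node_of_root_eq_zero (lcs_two_le hh') (root_eq_zero_of_mem_lcs_two hh'), eq_wreath hg,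
    wreath_conj_node, theta, sec_node, psi_conj 2 (sec_mem_Gt hg _) (hs _).1, (hs _).2, theta,
    theta, sec_node]

lemma theta_eq_zero_of_mem_level_Kt {g : Equiv.Perm Word} (hg : g ∈ level Kt 1) : theta g = 0 := by
  obtain ⟨p, hp, rfl⟩ := mem_level_succ.1 hg
  rw [theta, sec_node, (Kt_le_ker_psi_two (hp 0)).2]

lemma theta_x_sq : theta (x ^ 2) = 1 := by
  rw [x_sq, theta, sec_node, pair_zero, psi_z_values.2.2]

/-- Both sections of an element of `Nt 1` have `psi 2` equal to `theta`. Thus one bit at a vertex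
controls `psi 2` at both of its children. -/
lemma ker_theta_le : theta_isHomOn.ker ≤ level (psi_isHomOn 2).ker 1 := by
  rintro g ⟨hg, hg'⟩
  obtain ⟨p, hp, rfl⟩ := mem_level_succ.1 (Nt_one_le_level hg)
  refine node_mem_level_succ.2 fun s => ⟨hp s, ?_⟩
  have h := (sec_of_mem_Nt_one hg s).2
  rwa [sec_node, hg'] at h

/-! ### Functions on the levels of the tree -/

/-- The functions on the vertices of level `n`, with values in `𝔽₂`. -/
abbrev LevelFun (n : ℕ) : Type := (Fin n → ZMod 2) → ZMod 2

/-- The function with the given restrictions to the two subtrees of the first level. -/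
def join {n : ℕ} : (ZMod 2 → LevelFun n) →ₗ[ZMod 2] LevelFun (n + 1) where
  toFun f σ := f (σ 0) (Fin.tail σ)
  map_add' _ _ := rfl
  map_smul' _ _ := rfl

/-- The restriction to a subtree of the first level. -/
def half {n : ℕ} (s : ZMod 2) : LevelFun (n + 1) →ₗ[ZMod 2] LevelFun n where
  toFun f σ := f (Fin.cons s σ)
  map_add' _ _ := rfl
  map_smul' _ _ := rfl

@[simp] lemma half_join {n : ℕ} (s : ZMod 2) (f : ZMod 2 → LevelFun n) :
    half s (join f) = f s := by
  ext σ
  simp [half, join]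

lemma join_half {n : ℕ} (f : LevelFun (n + 1)) : (join fun s => half s f) = f := by
  ext σ
  simp [half, join]

lemma half_ext {n : ℕ} {f g : LevelFun (n + 1)} (h : ∀ s, half s f = half s g) : f = g := by
  rw [← join_half f, ← join_half g]
  simp only [h]

/-- The functions corresponding to the elements `v n r`. -/
def w : (n r : ℕ) → LevelFun n
  | 0, _ => fun _ => 1
  | n + 1, r => join fun s => if s = 0 ∨ r % 2 = 1 then w n (r / 2) else 0

lemma half_zero_w (n r : ℕ) : half 0 (w (n + 1) r) = w n (r / 2) := by
  simp [w]

lemma half_one_w_even (n r : ℕ) : half 1 (w (n + 1) (2 * r)) = 0 := by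
  simp [w]

lemma half_zero_w_even (n r : ℕ) : half 0 (w (n + 1) (2 * r)) = w n r := by
  rw [half_zero_w]
  congr 1
  omega

lemma half_w_odd (n r : ℕ) (s : ZMod 2) : half s (w (n + 1) (2 * r + 1)) = w n r := by
  have h : (2 * r + 1) / 2 = r := by omega
  simp [w, h, Nat.add_mod]

/-- The filtration of the functions corresponding to `Vfil`. -/
def Wfil (n r : ℕ) : Submodule (ZMod 2) (LevelFun n) :=
  Submodule.span (ZMod 2) {f | ∃ s, r ≤ s ∧ s < 2 ^ n ∧ f = w n s}

lemma w_mem_Wfil {n r s : ℕ} (h : r ≤ s) (hs : s < 2 ^ n) : w n s ∈ Wfil n r :=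
  Submodule.subset_span ⟨s, h, hs, rfl⟩

lemma Wfil_anti {n r s : ℕ} (h : r ≤ s) : Wfil n s ≤ Wfil n r := by
  apply Submodule.span_mono
  rintro _ ⟨t, ht, ht', rfl⟩
  exact ⟨t, h.trans ht, ht', rfl⟩

lemma Wfil_eq_bot {n r : ℕ} (h : 2 ^ n ≤ r) : Wfil n r = ⊥ := by
  rw [Wfil, Submodule.span_eq_bot]
  rintro _ ⟨s, hs, hs', -⟩
  omega

/-- For each `t` the functions with indices `2t` and `2t + 1` are `(w t, 0)` and `(w t, w t)`, and
these span the same plane as `(w t, 0)` and `(0, w t)`. Hence a layer of even index is a product of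
two layers one level down, which drives the inductions on `n`. -/
lemma mem_Wfil_even {n r : ℕ} {f : LevelFun (n + 1)} :
    f ∈ Wfil (n + 1) (2 * r) ↔ ∀ s, half s f ∈ Wfil n r := by
  constructor
  · intro h s
    have key : Wfil (n + 1) (2 * r) ≤ (Wfil n r).comap (half s) := by
      rw [Wfil, Submodule.span_le]
      rintro _ ⟨t, ht, ht', rfl⟩
      rw [pow_succ] at ht'
      obtain ⟨u, rfl | rfl⟩ := Nat.even_or_odd' t
      · rcases zmod_two_cases s with rfl | rfl
        · simpa [half_zero_w_even] using w_mem_Wfil (by omega) (by omega)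
        · simp [half_one_w_even]
      · simpa [half_w_odd] using w_mem_Wfil (by omega) (by omega)
    exact key h
  · intro h
    have h0 : Wfil n r ≤ (Wfil (n + 1) (2 * r)).comap
        (join ∘ₗ LinearMap.single (ZMod 2) (fun _ => LevelFun n) 0) := by
      rw [Wfil, Submodule.span_le]
      rintro _ ⟨t, ht, ht', rfl⟩
      have : join (Pi.single 0 (w n t)) = w (n + 1) (2 * t) := by
        refine half_ext fun s => ?_
        rcases zmod_two_cases s with rfl | rfl
        · simp [half_zero_w_even]
        · simp [half_one_w_even]
      simpa [this] using w_mem_Wfil (by omega) (by rw [pow_succ]; omega)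
    have h01 : Wfil n r ≤ (Wfil (n + 1) (2 * r)).comap
        (join ∘ₗ LinearMap.pi fun _ => LinearMap.id) := by
      rw [Wfil, Submodule.span_le]
      rintro _ ⟨t, ht, ht', rfl⟩
      have : join (fun _ => w n t) = w (n + 1) (2 * t + 1) := by
        refine half_ext fun s => ?_
        rw [half_w_odd, half_join]
      simpa [LinearMap.pi, this] using w_mem_Wfil (by omega) (by rw [pow_succ]; omega)
    have hf : f = join (fun _ => half 1 f) + join (Pi.single 0 (half 0 f - half 1 f)) := by
      refine half_ext fun s => ?_
      rcases zmod_two_cases s with rfl | rfl <;> simp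
    rw [hf]
    exact add_mem (h01 (h 1)) (h0 (sub_mem (h 0) (h 1)))

lemma Wfil_zero (n : ℕ) : Wfil n 0 = ⊤ := by
  induction n with
  | zero =>
    rw [eq_top_iff]
    intro f _
    have : f = f 0 • w 0 0 := by
      ext σ
      rw [Subsingleton.elim σ 0]
      simp [w]
    rw [this]
    exact Submodule.smul_mem _ _ (w_mem_Wfil le_rfl (by norm_num))
  | succ n ih =>
    rw [eq_top_iff]
    intro f _
    rw [show 0 = 2 * 0 from rfl, mem_Wfil_even, ih]
    exact fun s => Submodule.mem_top

lemma finrank_Wfil {n r : ℕ} : Module.finrank (ZMod 2) (Wfil n r) = 2 ^ n - r := by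
  have hspan : ∀ r, Wfil n r =
      Submodule.span (ZMod 2) (Set.range fun i : {i : Fin (2 ^ n) // r ≤ i} => w n i) := by
    intro r
    rw [Wfil]
    congr 1
    ext f
    constructor
    · rintro ⟨s, hs, hs', rfl⟩
      exact ⟨⟨⟨s, hs'⟩, hs⟩, rfl⟩
    · rintro ⟨⟨⟨s, hs'⟩, hs⟩, rfl⟩
      exact ⟨s, hs, hs', rfl⟩
  -- The `2 ^ n` functions span a space of dimension `2 ^ n`, hence are independent. The truncated
  -- difference in the final count covers `r ≥ 2 ^ n`.
  have hli : LinearIndependent (ZMod 2) fun i : Fin (2 ^ n) => w n i := by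
    apply linearIndependent_of_top_le_span_of_card_eq_finrank
    · rw [← Wfil_zero, Wfil, Submodule.span_le]
      rintro _ ⟨s, -, hs, rfl⟩
      exact Submodule.subset_span ⟨⟨s, hs⟩, rfl⟩
    · simp
  rw [hspan r]
  have h := finrank_span_eq_card (R := ZMod 2)
    (hli.comp (fun i : {i : Fin (2 ^ n) // r ≤ i} => (i : Fin (2 ^ n))) Subtype.val_injective)
  refine Eq.trans h ?_
  rw [Fintype.card_subtype, ← Finset.card_map Fin.valEmbedding]
  have : (Finset.univ.filter fun i : Fin (2 ^ n) => r ≤ i).map Fin.valEmbedding =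
      Finset.Ico r (2 ^ n) := by
    ext i
    simp only [Finset.mem_map, Finset.mem_filter, Finset.mem_univ, true_and,
      Fin.valEmbedding_apply, Finset.mem_Ico]
    constructor
    · rintro ⟨j, hj, rfl⟩
      exact ⟨hj, j.2⟩
    · rintro ⟨h1, h2⟩
      exact ⟨⟨i, h2⟩, h1, rfl⟩
  rw [this, Nat.card_Ico]

/-- A subspace contains `Wfil n r` as soon as it contains approximations of the generators. -/
lemma Wfil_le_of_approx {n r : ℕ} {U : Submodule (ZMod 2) (LevelFun n)}
    (h : ∀ s, r ≤ s → s < 2 ^ n → ∃ u ∈ U, u - w n s ∈ Wfil n (s + 1)) : Wfil n r ≤ U := by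
  -- Descending induction on `s`, with `k` bounding the distance to `2 ^ n`, where the layer is
  -- zero.
  have key : ∀ k s, r ≤ s → 2 ^ n ≤ s + k → Wfil n s ≤ U := by
    intro k
    induction k with
    | zero =>
      intro s _ hs
      rw [Wfil_eq_bot (by simpa using hs)]
      exact bot_le
    | succ k ih =>
      intro s hrs hs
      have hsucc : Wfil n (s + 1) ≤ U := ih (s + 1) (by omega) (by omega)
      rw [Wfil, Submodule.span_le]
      rintro _ ⟨t, ht, ht', rfl⟩
      rcases ht.eq_or_lt with rfl | ht
      · obtain ⟨u, hu, hu'⟩ := h s hrs ht'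
        rw [SetLike.mem_coe, ← sub_sub_cancel u (w n s)]
        exact sub_mem hu (hsucc hu')
      · exact hsucc (w_mem_Wfil ht ht')
  exact key (2 ^ n) r le_rfl (by omega)

/-! ### The action on the functions -/

/-- The action of a tree automorphism on the functions on the vertices of level `n`. -/
def act : (n : ℕ) → Equiv.Perm Word → LevelFun n →ₗ[ZMod 2] LevelFun n
  | 0, _ => LinearMap.id
  | n + 1, g => join ∘ₗ LinearMap.pi fun s => act n (sec g (s + root g)) ∘ₗ half (s + root g)

@[simp] lemma half_act {n : ℕ} (s : ZMod 2) (g : Equiv.Perm Word) (f : LevelFun (n + 1)) :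
    half s (act (n + 1) g f) = act n (sec g (s + root g)) (half (s + root g) f) := by
  simp [act]

lemma act_one (n : ℕ) (f : LevelFun n) : act n 1 f = f := by
  induction n with
  | zero => rfl
  | succ n ih =>
    refine half_ext fun s => ?_
    rw [← map_one node, half_act, root_node, sec_node, add_zero, Pi.one_apply, ih]

lemma half_act_a {n : ℕ} (s : ZMod 2) (f : LevelFun (n + 1)) :
    half s (act (n + 1) a f) = half (s + 1) f := by
  rw [half_act, root_a, sec_a, Pi.one_apply, act_one]

lemma half_act_node {n : ℕ} (s : ZMod 2) (p : ZMod 2 → Equiv.Perm Word) (f : LevelFun (n + 1)) :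
    half s (act (n + 1) (node p) f) = act n (p s) (half s f) := by
  rw [half_act, root_node, sec_node, add_zero]

/-- Tree automorphisms act trivially on the factors of the filtration. -/
lemma act_sub_mem {n r : ℕ} (g : Equiv.Perm Word) {f : LevelFun n} (hf : f ∈ Wfil n r) :
    act n g f - f ∈ Wfil n (r + 1) := by
  have key : ∀ n g s, s < 2 ^ n → act n g (w n s) - w n s ∈ Wfil n (s + 1) := by
    intro n
    induction n with
    | zero => simp [act]
    | succ n ih =>
      intro g s hs
      rw [pow_succ] at hs
      obtain ⟨t, rfl | rfl⟩ := Nat.even_or_odd' s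
      · have ht := ih (sec g 0) t (by omega)
        rcases zmod_two_cases (root g) with h | h
        · apply Wfil_anti (show 2 * t + 1 ≤ 2 * (t + 1) by omega)
          rw [mem_Wfil_even]
          intro s
          rw [map_sub, half_act, h, add_zero]
          rcases zmod_two_cases s with rfl | rfl
          · rwa [half_zero_w_even]
          · simp [half_one_w_even]
        · have h2 : act (n + 1) g (w (n + 1) (2 * t)) - w (n + 1) (2 * t)
              - w (n + 1) (2 * t + 1) ∈ Wfil (n + 1) (2 * (t + 1)) := by
            rw [mem_Wfil_even]
            intro s
            rw [map_sub, map_sub, half_act, h, half_w_odd]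
            rcases zmod_two_cases s with rfl | rfl
            · rw [zero_add, half_one_w_even, half_zero_w_even, map_zero, zero_sub,
                CharTwo.neg_eq, sub_self]
              exact zero_mem _
            · rwa [zmod_two_add_self, half_one_w_even, half_zero_w_even, sub_zero]
          rw [← sub_add_cancel (act (n + 1) g (w (n + 1) (2 * t)) - w (n + 1) (2 * t))
            (w (n + 1) (2 * t + 1))]
          exact add_mem (Wfil_anti (by omega) h2) (w_mem_Wfil le_rfl (by rw [pow_succ]; omega))
      · rw [show 2 * t + 1 + 1 = 2 * (t + 1) by ring, mem_Wfil_even]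
        intro s
        rw [map_sub, half_act, half_w_odd, half_w_odd]
        exact ih _ t (by omega)
  have hle : Wfil n r ≤ (Wfil n (r + 1)).comap (act n g - LinearMap.id) := by
    rw [Wfil, Submodule.span_le]
    rintro _ ⟨s, hs, hs', rfl⟩
    exact Wfil_anti (by omega) (key n g s hs')
  exact hle hf

lemma act_c_w_even (n r : ℕ) : act n c (w n (2 * r)) = w n (2 * r) := by
  cases n with
  | zero => rfl
  | succ n =>
    refine half_ext fun s => ?_
    rw [c_eq, half_act_node]
    rcases zmod_two_cases s with rfl | rfl
    · rw [pair_zero, act_one]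
    · rw [half_one_w_even, map_zero]

lemma act_a_w_odd (n r : ℕ) : act n a (w n (2 * r + 1)) = w n (2 * r + 1) := by
  cases n with
  | zero => rfl
  | succ n =>
    refine half_ext fun s => ?_
    rw [half_act_a, half_w_odd, half_w_odd]

lemma act_a_w_even (n r : ℕ) :
    act (n + 1) a (w (n + 1) (2 * r)) - w (n + 1) (2 * r) = w (n + 1) (2 * r + 1) := by
  refine half_ext fun s => ?_
  rw [map_sub, half_act_a, half_w_odd]
  rcases zmod_two_cases s with rfl | rfl
  · rw [zero_add, half_one_w_even, half_zero_w_even, zero_sub, CharTwo.neg_eq]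
  · rw [zmod_two_add_self, half_one_w_even, half_zero_w_even, sub_zero]

/-- The step of the induction in `exists_act_w_odd`: `g = (g₀, g₁)`, where `g₀` acts trivially and
`g₁` moves `w n t` to the next layer. -/
lemma act_node_pair_w_odd {n t : ℕ} {g h : Equiv.Perm Word} (ht : t + 1 < 2 ^ n)
    (hg : act n g (w n t) = w n t) (hh : act n h (w n t) - w n t - w n (t + 1) ∈ Wfil n (t + 2)) :
    act (n + 1) (node (pair g h)) (w (n + 1) (2 * t + 1)) - w (n + 1) (2 * t + 1)
      - w (n + 1) (2 * t + 2) ∈ Wfil (n + 1) (2 * t + 3) := by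
  -- Modulo later terms the difference is `(0, w (t + 1))`, which in characteristic 2 is the sum of
  -- the two basis functions `2t + 2` and `2t + 3`; the second lies in the layer allowed by the
  -- goal.
  have key : act (n + 1) (node (pair g h)) (w (n + 1) (2 * t + 1)) - w (n + 1) (2 * t + 1)
      - w (n + 1) (2 * t + 2) - w (n + 1) (2 * t + 3) ∈ Wfil (n + 1) (2 * (t + 2)) := by
    rw [mem_Wfil_even]
    intro s
    rw [show 2 * t + 2 = 2 * (t + 1) by ring, show 2 * t + 3 = 2 * (t + 1) + 1 by ring, map_sub,
      map_sub, map_sub, half_act_node, half_w_odd, half_w_odd]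
    rcases zmod_two_cases s with rfl | rfl
    · rw [pair_zero, hg, half_zero_w_even, sub_self, zero_sub, CharTwo.neg_eq, sub_self]
      exact zero_mem _
    · rwa [pair_one, half_one_w_even, sub_zero]
  rw [← sub_add_cancel (_ - w (n + 1) (2 * t + 2)) (w (n + 1) (2 * t + 3))]
  exact add_mem (Wfil_anti (by omega) key) (w_mem_Wfil le_rfl (by rw [pow_succ]; omega))

/-- The generator is found by induction on the level. If `t` is even, `b = (a, c)` works: `a`
advances the left half and `c` fixes the right one. If `t = 2u + 1`, the generator for `u` is lifted
to the one having it as right entry: `b` to `d = (1, b)`, `c` to `b = (a, c)`, `d` to `c = (1, d)`.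
The left entries act trivially because `a` fixes functions of odd index. -/
lemma exists_act_w_odd {n t : ℕ} (h : 2 * t + 2 < 2 ^ n) :
    ∃ g, (g = b ∨ g = c ∨ g = d) ∧
      act n g (w n (2 * t + 1)) - w n (2 * t + 1) - w n (2 * t + 2) ∈ Wfil n (2 * t + 3) := by
  induction n generalizing t with
  | zero => simp at h
  | succ n ih =>
    have h' : t + 1 < 2 ^ n := by rw [pow_succ] at h; omega
    obtain ⟨u, rfl | rfl⟩ := Nat.even_or_odd' t
    · obtain _ | n := n
      · simp at h'
      refine ⟨b, Or.inl rfl, ?_⟩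
      have key : act (n + 1 + 1) b (w (n + 1 + 1) (2 * (2 * u) + 1))
          - w (n + 1 + 1) (2 * (2 * u) + 1) = w (n + 1 + 1) (2 * (2 * u) + 2) := by
        refine half_ext fun s => ?_
        rw [show 2 * (2 * u) + 2 = 2 * (2 * u + 1) by ring, map_sub, b_eq, half_act_node,
          half_w_odd]
        rcases zmod_two_cases s with rfl | rfl
        · rw [pair_zero, half_zero_w_even, act_a_w_even]
        · rw [pair_one, half_one_w_even, act_c_w_even, sub_self]
      rw [key, sub_self]
      exact zero_mem _
    · obtain ⟨g, hg, H⟩ := ih (t := u) (by omega)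
      rcases hg with rfl | rfl | rfl
      · refine ⟨d, by simp, ?_⟩
        rw [d_eq]
        exact act_node_pair_w_odd h' (act_one _ _) H
      · refine ⟨b, by simp, ?_⟩
        rw [b_eq]
        exact act_node_pair_w_odd h' (act_a_w_odd _ _) H
      · refine ⟨c, by simp, ?_⟩
        rw [c_eq]
        exact act_node_pair_w_odd h' (act_one _ _) H

/-- Some generator moves `w n r` to the next layer of the filtration. -/
lemma exists_act_w {n r : ℕ} (h : r + 1 < 2 ^ n) :
    ∃ g ∈ Gt, act n g (w n r) - w n r - w n (r + 1) ∈ Wfil n (r + 2) := by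
  obtain ⟨t, rfl | rfl⟩ := Nat.even_or_odd' r
  · obtain _ | n := n
    · simp at h
    refine ⟨a, a_mem_Gt, ?_⟩
    rw [act_a_w_even, sub_self]
    exact zero_mem _
  · obtain ⟨g, hg, H⟩ := exists_act_w_odd (n := n) (t := t) (by omega)
    refine ⟨g, ?_, H⟩
    rcases hg with rfl | rfl | rfl
    exacts [b_mem_Gt, c_mem_Gt, d_mem_Gt]

/-! ### Comparison with the group algebra -/

/-- The element of `V n` with the given coefficients. -/
def toV (n : ℕ) : LevelFun n ≃ₗ[ZMod 2] V n :=
  (Finsupp.linearEquivFunOnFinite (ZMod 2) (ZMod 2) (Fin n → ZMod 2)).symm.trans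
    (AddMonoidAlgebra.coeffLinearEquiv (ZMod 2)).symm

lemma toV_single {n : ℕ} (σ : Fin n → ZMod 2) : toV n (Pi.single σ 1) = monom σ := by
  rw [toV, LinearEquiv.trans_apply, Finsupp.linearEquivFunOnFinite_symm_single]
  rfl

/-- The inclusion of `V n` in `V (n + 1)` which raises the indices of the variables by one. -/
def shiftV (n : ℕ) : V n →ₐ[ZMod 2] V (n + 1) :=
  AddMonoidAlgebra.mapDomainAlgHom (ZMod 2) (ZMod 2)
    { toFun := fun σ : Fin n → ZMod 2 => (Fin.cons 0 σ : Fin (n + 1) → ZMod 2)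
      map_zero' := by ext i; refine Fin.cases ?_ (fun i => ?_) i <;> simp
      map_add' := fun σ τ => by ext i; refine Fin.cases ?_ (fun i => ?_) i <;> simp }

lemma shiftV_monom {n : ℕ} (σ : Fin n → ZMod 2) :
    shiftV n (monom σ) = monom (Fin.cons 0 σ) := by
  exact AddMonoidAlgebra.mapDomain_single

lemma monom_mul_monom {n : ℕ} (σ τ : Fin n → ZMod 2) :
    monom σ * monom τ = monom (σ + τ) := by
  simp [monom]

lemma v_succ (n r : ℕ) :
    v (n + 1) r = (1 - monom (Pi.single 0 1)) ^ (r % 2) * shiftV n (v n (r / 2)) := by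
  rw [v, Fin.prod_univ_succ, v, map_prod]
  congr 1
  · simp
  · refine Finset.prod_congr rfl fun i _ => ?_
    rw [map_pow, map_sub, map_one, shiftV_monom, Fin.val_succ, pow_succ', Nat.div_div_eq_div_mul]
    congr 3
    ext j
    refine Fin.cases ?_ (fun j => ?_) j
    · simp
    · simp [Pi.single_apply]

/-- The first letter of a vertex is the exponent of the first variable; the remaining letters belong
to the variables with shifted indices. -/
lemma toV_join_single (n : ℕ) (s : ZMod 2) (f : LevelFun n) :
    toV (n + 1) (join (Pi.single s f)) = monom (Pi.single 0 s) * shiftV n (toV n f) := by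
  have key : (toV (n + 1)).toLinearMap ∘ₗ join ∘ₗ
      LinearMap.single (ZMod 2) (fun _ => LevelFun n) s =
      LinearMap.mulLeft (ZMod 2) (monom (Pi.single 0 s)) ∘ₗ (shiftV n).toLinearMap ∘ₗ
        (toV n).toLinearMap := by
    refine (Pi.basisFun (ZMod 2) (Fin n → ZMod 2)).ext fun σ => ?_
    have h : join (Pi.single s (Pi.single σ 1)) =
        (Pi.single (Fin.cons s σ) 1 : LevelFun (n + 1)) := by
      refine half_ext fun t => ?_
      rw [half_join]
      ext τ
      rcases eq_or_ne t s with rfl | hts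
      · simp [half, Pi.single_apply, Fin.cons_inj]
      · simp [half, Fin.cons_inj, hts]
    simp only [Pi.basisFun_apply, LinearMap.comp_apply, LinearMap.coe_single,
      LinearEquiv.coe_coe, h, toV_single, LinearMap.mulLeft_apply, AlgHom.toLinearMap_apply,
      shiftV_monom, monom_mul_monom]
    congr 1
    ext i
    refine Fin.cases ?_ (fun i => ?_) i <;> simp
  exact LinearMap.congr_fun key f

lemma toV_w (n r : ℕ) : toV n (w n r) = v n r := by
  induction n generalizing r with
  | zero =>
    have : w 0 r = Pi.single 0 1 := by
      ext σ
      rw [Subsingleton.elim σ 0]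
      simp [w]
    rw [this, toV_single, v]
    rfl
  | succ n ih =>
    rw [v_succ, ← ih]
    have hone : (monom (Pi.single 0 0) : V (n + 1)) = 1 := by
      rw [Pi.single_zero]; rfl
    rcases Nat.mod_two_eq_zero_or_one r with h | h
    · have : w (n + 1) r = join (Pi.single 0 (w n (r / 2))) := by
        rw [w]
        congr 1
        ext1 s
        rcases zmod_two_cases s with rfl | rfl <;> simp [h]
      rw [this, toV_join_single, h, pow_zero, hone]
    -- In characteristic 2, `(f, f) = (f, 0) - (0, f)`, which is multiplication by `1 - X₁`.
    · have : w (n + 1) r = join (Pi.single 0 (w n (r / 2))) - join (Pi.single 1 (w n (r / 2))) := by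
        rw [w, ← map_sub]
        congr 1
        ext1 s
        rcases zmod_two_cases s with rfl | rfl <;> simp [h, CharTwo.neg_eq]
      rw [this, map_sub, toV_join_single, toV_join_single, h, pow_one, hone, sub_mul]

lemma map_toV_Wfil (n r : ℕ) : (Wfil n r).map (toV n).toLinearMap = Vfil n r := by
  rw [Wfil, Submodule.map_span, Vfil]
  congr 1
  ext f
  constructor
  · rintro ⟨_, ⟨s, hs, hs', rfl⟩, rfl⟩
    exact ⟨s, hs, hs', toV_w n s⟩
  · rintro ⟨s, hs, hs', rfl⟩
    exact ⟨_, ⟨s, hs, hs', rfl⟩, toV_w n s⟩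

lemma toV_mem_Vfil {n r : ℕ} {f : LevelFun n} : toV n f ∈ Vfil n r ↔ f ∈ Wfil n r := by
  rw [← map_toV_Wfil]
  exact (toV n).injective.mem_set_image

/-! ### The coordinates of the elements of the level subgroups -/

/-- The values of `f` on the sections of `g` at the vertices of level `n`. -/
def coord (f : Equiv.Perm Word → ZMod 2) : (n : ℕ) → Equiv.Perm Word → LevelFun n
  | 0, g => fun _ => f g
  | n + 1, g => join fun s => coord f n (sec g s)

section Coord

variable {f : Equiv.Perm Word → ZMod 2} {Q R : Subgroup (Equiv.Perm Word)}

lemma coord_node (n : ℕ) (p : ZMod 2 → Equiv.Perm Word) :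
    coord f (n + 1) (node p) = join fun s => coord f n (p s) := by
  rw [coord, sec_node]

lemma coord_mul (hf : IsHomOn f Q) (n : ℕ) {g h : Equiv.Perm Word} (hg : g ∈ level Q n)
    (hh : h ∈ level Q n) : coord f n (g * h) = coord f n g + coord f n h := by
  induction n generalizing g h with
  | zero => ext σ; exact hf g hg h hh
  | succ n ih =>
    obtain ⟨p, hp, rfl⟩ := mem_level_succ.1 hg
    obtain ⟨q, hq, rfl⟩ := mem_level_succ.1 hh
    rw [← map_mul, coord_node, coord_node, coord_node, ← map_add]
    congr 1
    ext1 s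
    exact ih (hp s) (hq s)

/-- An invariant `f` ignores conjugation of a section within `G̃`, so only the permutation of the
vertices remains. -/
lemma coord_conj (hf : ∀ g ∈ Gt, ∀ h ∈ Q, f (g * h * g⁻¹) = f h) (n : ℕ) {g h : Equiv.Perm Word}
    (hg : g ∈ Gt) (hh : h ∈ level Q n) :
    coord f n (g * h * g⁻¹) = act n g (coord f n h) := by
  induction n generalizing g h with
  | zero => ext σ; exact hf g hg h hh
  | succ n ih =>
    obtain ⟨q, hq, rfl⟩ := mem_level_succ.1 hh
    obtain ⟨i, p, hp, rfl⟩ := exists_wreath_of_mem_Gt hg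
    refine half_ext fun s => ?_
    rw [wreath_conj_node, coord_node, coord_node, half_act, half_join, half_join, root_wreath,
      sec_wreath]
    exact ih (hp _) (hq _)

lemma coord_eq_zero (hf : ∀ g ∈ R, f g = 0) {n : ℕ} {g : Equiv.Perm Word} (hg : g ∈ level R n) :
    coord f n g = 0 := by
  induction n generalizing g with
  | zero => ext σ; exact hf g hg
  | succ n ih =>
    obtain ⟨p, hp, rfl⟩ := mem_level_succ.1 hg
    refine half_ext fun s => ?_
    rw [coord_node, half_join, ih (hp s), map_zero]

lemma mem_level_ker_of_coord_eq_zero (hf : IsHomOn f Q) {n : ℕ} {g : Equiv.Perm Word}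
    (hg : g ∈ level Q n) (h : coord f n g = 0) : g ∈ level hf.ker n := by
  induction n generalizing g with
  | zero => exact ⟨hg, congrFun h 0⟩
  | succ n ih =>
    obtain ⟨p, hp, rfl⟩ := mem_level_succ.1 hg
    refine node_mem_level_succ.2 fun s => ih (hp s) ?_
    rw [coord_node] at h
    rw [← half_join s fun s => coord f n (p s), h, map_zero]

lemma coord_atVertex (hf : f 1 = 0) {n : ℕ} (q : Equiv.Perm Word) (σ : Fin n → ZMod 2) :
    coord f n (atVertex q (List.ofFn σ)) = f q • Pi.single σ 1 := by
  induction n with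
  | zero =>
    ext τ
    rw [Subsingleton.elim τ σ]
    simp [coord, atVertex]
  | succ n ih =>
    have h1 : coord f n 1 = 0 :=
      coord_eq_zero (R := ⊥) (fun g hg => by rw [Subgroup.mem_bot.1 hg, hf]) (one_mem _)
    rw [List.ofFn_succ, atVertex, coord_node]
    refine half_ext fun s => ?_
    rw [half_join, map_smul]
    by_cases hs : s = σ 0
    · subst hs
      have : half (σ 0) (Pi.single σ 1 : LevelFun (n + 1)) =
          Pi.single (fun i : Fin n => σ i.succ) 1 := by
        ext τ
        have : Fin.cons (σ 0) τ = σ ↔ τ = fun i => σ i.succ := by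
          conv_lhs => rw [← Fin.cons_self_tail σ]
          rw [Fin.cons_inj]
          simp [Fin.tail_def]
        simp [half, Pi.single_apply, this]
      rw [Pi.mulSingle_eq_same, ih, this]
    · have : half s (Pi.single σ 1 : LevelFun (n + 1)) = 0 := by
        ext τ
        have : Fin.cons s τ ≠ σ := by
          rintro rfl
          exact hs rfl
        simp [half, this]
      rw [Pi.mulSingle_eq_of_ne hs, h1, this, smul_zero]

end Coord

/-- The element `(q, …, q)`. -/
def diag (q : Equiv.Perm Word) : ℕ → Equiv.Perm Word
  | 0 => q
  | n + 1 => node (pair (diag q n) (diag q n))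

lemma diag_mem_level {Q : Subgroup (Equiv.Perm Word)} {q : Equiv.Perm Word} (hq : q ∈ Q) (n : ℕ) :
    diag q n ∈ level Q n := by
  induction n with
  | zero => exact hq
  | succ n ih => exact node_pair_mem_level_succ.2 ⟨ih, ih⟩

/-- A constant function is a multiple of the last basis function, the product of all `1 - X_i`. -/
lemma coord_diag (f : Equiv.Perm Word → ZMod 2) (q : Equiv.Perm Word) (n : ℕ) :
    coord f n (diag q n) = f q • w n (2 ^ n - 1) := by
  induction n with
  | zero => ext σ; simp [coord, diag, w]
  | succ n ih =>
    have h : 2 ^ (n + 1) - 1 = 2 * (2 ^ n - 1) + 1 := by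
      have := Nat.one_le_two_pow (n := n)
      rw [pow_succ]; omega
    refine half_ext fun s => ?_
    rw [diag, coord_node, half_join, map_smul, h, half_w_odd, ← ih]
    rcases zmod_two_cases s with rfl | rfl <;> rfl

/-- The commutators of `(x, …, x)` with the generators generate the next `Ñ` normally. -/
lemma Nt_le_of_commutator_diag_mem {m : ℕ} {H : Subgroup (Equiv.Perm Word)} (hH : NormBy Gt H)
    (hb : ⁅diag x m, b⁆ ∈ H) (hc : ⁅diag x m, c⁆ ∈ H) (hd : ⁅diag x m, d⁆ ∈ H) :
    Nt (m + 1) ≤ H := by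
  suffices h : ∃ w w' : Word, w.length = w'.length + 1 ∧ w'.length = m ∧ atVertex x w ∈ H ∧
      atVertex y w ∈ H ∧ atVertex (x ^ 2) w' ∈ H by
    obtain ⟨w, w', hw, rfl, h1, h2, h3⟩ := h
    exact Nt_succ_le hH hw h1 h2 h3
  induction m generalizing H with
  | zero =>
    rw [diag] at hb hc hd
    rw [commutator_x_b] at hb
    rw [commutator_x_c, ← mulSingle_one_eq_pair] at hc
    rw [commutator_x_d, ← mulSingle_one_eq_pair] at hd
    exact ⟨[1], [], rfl, rfl, hd, hc, hb⟩
  | succ m ih =>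
    rw [diag, b_eq, commutator_node_pair] at hb
    rw [diag, c_eq, commutator_node_pair, commutatorElement_one_right] at hc
    rw [diag, d_eq, commutator_node_pair, commutatorElement_one_right] at hd
    -- This is the left entry of `hb`, to be divided out. For `m = 0` it equals `([x, b], 1)`, since
    -- `[x, a] = [x, b]`, and this is the conjugate by `a` of `hd`. For larger `m` the element `diag
    -- x m` is symmetric and commutes with `a`.
    have hswap : node (pair ⁅diag x m, a⁆ 1) ∈ H := by
      cases m with
      | zero =>
        have h := hH a a_mem_Gt _ hd
        rwa [a_inv, a_conj_node_pair, diag, commutator_x_b, ← commutator_x_a] at h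
      | succ m =>
        rw [diag, commutator_node_pair_a, pair_one_one, map_one]
        exact one_mem _
    have hb' : node (pair 1 ⁅diag x m, c⁆) ∈ H := by
      have h := mul_mem (inv_mem hswap) hb
      rwa [node_pair_inv, node_pair_mul, inv_mul_cancel, inv_one, one_mul] at h
    rw [← mulSingle_one_eq_pair, ← nodeSingle_apply] at hc hd hb'
    -- In the right subtree the generators rotate: the right entries of `d`, `b`, `c` are `b`, `c`,
    -- `d`, whence the order of the arguments.
    obtain ⟨w, w', hw, rfl, h1, h2, h3⟩ := ih (normBy_comap_nodeSingle hH 1) hd hb' hc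
    exact ⟨1 :: w, 1 :: w', by simp [hw], rfl, h1, h2, h3⟩

/-! ### The subgroups `Ñ_m` and their filtrations -/

lemma Nt_one_le_Kt : Nt 1 ≤ Kt := by
  have hK : NormBy Gt Kt := normBy_conjClosure _ _
  apply Nt_succ_le hK (w := [1]) (w' := []) rfl
  · rw [atVertex, mulSingle_one_eq_pair, atVertex, ← commutator_x_d]
    exact hK.commutator_le (Subgroup.commutator_mem_commutator x_mem_Kt d_mem_Gt)
  · rw [atVertex, mulSingle_one_eq_pair, atVertex, ← commutator_x_c]
    exact hK.commutator_le (Subgroup.commutator_mem_commutator x_mem_Kt c_mem_Gt)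
  · exact pow_mem x_mem_Kt 2

lemma Nt_succ_succ_le (k : ℕ) : Nt (k + 2) ≤ Nt (k + 1) := by
  rw [Nt_succ_eq (k + 1), Nt_succ_eq k, ← level_level_one]
  exact level_mono ((level_mono Nt_one_le_Kt 1).trans le_sup_left) k

/-- All sections at level `k + 1` lie in `γ₂`, where `psi` is a homomorphism; this makes the first
two coordinates additive. -/
lemma Nt_succ_le_level (k : ℕ) : Nt (k + 1) ≤ level (lcs Gt 2) (k + 1) := by
  rw [Nt_succ_eq, ← level_level_one]
  exact level_mono Nt_one_le_level k

/-- The three components of `α ⊕ β ⊕ γ`, as functions on the levels. -/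
abbrev Triple (k : ℕ) : Type := LevelFun (k + 1) × LevelFun (k + 1) × LevelFun k

/-- The map `α ⊕ β ⊕ γ`, with values in the functions on the levels. -/
def phiFun (k : ℕ) (g : Equiv.Perm Word) : Triple k :=
  (coord (psi 0) (k + 1) g, coord (psi 1) (k + 1) g, coord theta k g)

lemma phiFun_mul {k : ℕ} {g h : Equiv.Perm Word} (hg : g ∈ Nt (k + 1)) (hh : h ∈ Nt (k + 1)) :
    phiFun k (g * h) = phiFun k g + phiFun k h := by
  have hg' := Nt_succ_le_level k hg
  have hh' := Nt_succ_le_level k hh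
  rw [Nt_succ_eq] at hg hh
  rw [phiFun, coord_mul (psi_isHomOn 0) _ hg' hh', coord_mul (psi_isHomOn 1) _ hg' hh',
    coord_mul theta_isHomOn _ hg hh]
  rfl

lemma phiFun_one (k : ℕ) : phiFun k 1 = 0 := by
  have h := phiFun_mul (one_mem (Nt (k + 1))) (one_mem _)
  simpa using h

lemma triple_add_self {k : ℕ} (t : Triple k) : t + t = 0 := by
  have h : ∀ {n : ℕ} (f : LevelFun n), f + f = 0 := fun f => by
    ext σ; exact zmod_two_add_self _
  exact Prod.ext (h _) (Prod.ext (h _) (h _))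

lemma triple_neg {k : ℕ} (t : Triple k) : -t = t :=
  neg_eq_of_add_eq_zero_left (triple_add_self t)

lemma phiFun_inv {k : ℕ} {g : Equiv.Perm Word} (hg : g ∈ Nt (k + 1)) :
    phiFun k g⁻¹ = phiFun k g := by
  have h := phiFun_mul (inv_mem hg) hg
  rw [inv_mul_cancel, phiFun_one] at h
  rw [← triple_neg (phiFun k g)]
  exact eq_neg_of_add_eq_zero_left h.symm

/-- The action on the triples. -/
def actTriple (k : ℕ) (g : Equiv.Perm Word) : Triple k →ₗ[ZMod 2] Triple k :=
  (act (k + 1) g).prodMap ((act (k + 1) g).prodMap (act k g))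

lemma phiFun_conj {k : ℕ} {g h : Equiv.Perm Word} (hg : g ∈ Gt) (hh : h ∈ Nt (k + 1)) :
    phiFun k (g * h * g⁻¹) = actTriple k g (phiFun k h) := by
  have hh' := Nt_succ_le_level k hh
  rw [Nt_succ_eq] at hh
  rw [phiFun, coord_conj (fun _ hg _ hh => psi_conj 0 hg hh) _ hg hh',
    coord_conj (fun _ hg _ hh => psi_conj 1 hg hh) _ hg hh',
    coord_conj (fun _ hg _ hh => theta_conj hg hh) _ hg hh]
  rfl

/-- From `[h, g] = h · (g h⁻¹ g⁻¹)` and invariance of the characters: group commutators turn into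
the operators `g - 1`. -/
lemma phiFun_commutator {k : ℕ} {g h : Equiv.Perm Word} (hg : g ∈ Gt) (hh : h ∈ Nt (k + 1)) :
    phiFun k ⁅h, g⁆ = actTriple k g (phiFun k h) - phiFun k h := by
  have h' : ⁅h, g⁆ = h * (g * h⁻¹ * g⁻¹) := by
    simp only [commutatorElement_def, mul_assoc]
  rw [h', phiFun_mul hh (normBy_Nt _ g hg _ (inv_mem hh)), phiFun_conj hg (inv_mem hh),
    phiFun_inv hh, add_comm, sub_eq_add_neg, triple_neg]

/-- Membership of a section in `Nt 1` is decided by `psi 0`, `psi 1`, `psi 2`. The first two are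
coordinates at level `k + 1`, and the third is carried by `theta` at level `k`. -/
lemma phiFun_eq_zero_iff {k : ℕ} {g : Equiv.Perm Word} (hg : g ∈ Nt (k + 1)) :
    phiFun k g = 0 ↔ g ∈ Nt (k + 2) := by
  rw [Nt_succ_eq (k + 1)]
  constructor
  · intro h
    have h0 := mem_level_ker_of_coord_eq_zero (psi_isHomOn 0) (Nt_succ_le_level k hg)
      (congrArg Prod.fst h)
    have h1 := mem_level_ker_of_coord_eq_zero (psi_isHomOn 1) (Nt_succ_le_level k hg)
      (congrArg (fun t => t.2.1) h)
    rw [Nt_succ_eq] at hg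
    have h2 := level_mono ker_theta_le k
      (mem_level_ker_of_coord_eq_zero theta_isHomOn hg (congrArg (fun t => t.2.2) h))
    rw [level_level_one] at h2
    have h3 : g ∈ level ((psi_isHomOn 0).ker ⊓ (psi_isHomOn 1).ker ⊓ (psi_isHomOn 2).ker)
        (k + 1) := by
      rw [level_inf, level_inf]
      exact ⟨⟨h0, h1⟩, h2⟩
    refine level_mono ?_ _ h3
    rintro q ⟨⟨hq0, hq1⟩, hq2⟩
    refine mem_Nt_one_of_psi_eq_zero hq0.1 fun m hm => ?_
    interval_cases m
    exacts [hq0.2, hq1.2, hq2.2]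
  · intro h
    have hpsi : ∀ n, ∀ q ∈ Nt 1, psi n q = 0 := fun n q hq => (Nt_one_le_ker_psi n hq).2
    refine Prod.ext (coord_eq_zero (hpsi 0) h) (Prod.ext (coord_eq_zero (hpsi 1) h) ?_)
    rw [← level_level_one] at h
    refine coord_eq_zero (fun q hq => ?_) h
    obtain ⟨p, hp, rfl⟩ := mem_level_succ.1 hq
    rw [theta, sec_node]
    exact hpsi 2 _ (hp 0)

/-- The filtration of the triples. -/
def tripleFil (k r : ℕ) : Submodule (ZMod 2) (Triple k) :=
  (Wfil (k + 1) r).prod ((Wfil (k + 1) r).prod (Wfil k r))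

/-- The elements of `Ñ_{k+1}` with coordinates in `tripleFil k r`. -/
def NtFil (k r : ℕ) : Subgroup (Equiv.Perm Word) where
  carrier := {g | g ∈ Nt (k + 1) ∧ phiFun k g ∈ tripleFil k r}
  one_mem' := ⟨one_mem _, by rw [phiFun_one]; exact zero_mem _⟩
  mul_mem' := by
    rintro g h ⟨hg, hg'⟩ ⟨hh, hh'⟩
    exact ⟨mul_mem hg hh, by rw [phiFun_mul hg hh]; exact add_mem hg' hh'⟩
  inv_mem' := by
    rintro g ⟨hg, hg'⟩
    exact ⟨inv_mem hg, by rwa [phiFun_inv hg]⟩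

lemma mem_NtFil {k r : ℕ} {g : Equiv.Perm Word} :
    g ∈ NtFil k r ↔ g ∈ Nt (k + 1) ∧ phiFun k g ∈ tripleFil k r := Iff.rfl

lemma NtFil_zero (k : ℕ) : NtFil k 0 = Nt (k + 1) := by
  ext g
  rw [mem_NtFil, tripleFil, Wfil_zero, Wfil_zero]
  simp

/-- At this index all three filtrations have reached zero, so only the kernel of the coordinates
remains. This joins the end of one stretch of the series to the start of the next. -/
lemma NtFil_two_pow (k : ℕ) : NtFil k (2 ^ (k + 1)) = Nt (k + 2) := by
  have hbot : tripleFil k (2 ^ (k + 1)) = ⊥ := by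
    rw [tripleFil, Wfil_eq_bot le_rfl,
      Wfil_eq_bot (Nat.pow_le_pow_right two_pos (Nat.le_succ k)), Submodule.prod_bot,
      Submodule.prod_bot]
  ext g
  rw [mem_NtFil, hbot, Submodule.mem_bot]
  exact ⟨fun h => (phiFun_eq_zero_iff h.1).1 h.2, fun h =>
    ⟨Nt_succ_succ_le k h, (phiFun_eq_zero_iff (Nt_succ_succ_le k h)).2 h⟩⟩

/-- The image under `α ⊕ β ⊕ γ` of a subgroup of `Ñ_{k+1}`. -/
def phiImage (k : ℕ) {H : Subgroup (Equiv.Perm Word)} (hH : H ≤ Nt (k + 1)) :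
    Submodule (ZMod 2) (Triple k) where
  carrier := {t | ∃ q ∈ H, phiFun k q = t}
  zero_mem' := ⟨1, one_mem _, phiFun_one k⟩
  add_mem' := by
    rintro _ _ ⟨g, hg, rfl⟩ ⟨h, hh, rfl⟩
    exact ⟨g * h, mul_mem hg hh, phiFun_mul (hH hg) (hH hh)⟩
  smul_mem' := by
    rintro s _ ⟨g, hg, rfl⟩
    rcases zmod_two_cases s with rfl | rfl
    · exact ⟨1, one_mem _, by rw [phiFun_one, zero_smul]⟩
    · exact ⟨g, hg, by rw [one_smul]⟩

lemma prod_le_of_comap_le {M₁ M₂ M₃ : Type*} [AddCommGroup M₁] [AddCommGroup M₂] [AddCommGroup M₃]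
    [Module (ZMod 2) M₁] [Module (ZMod 2) M₂] [Module (ZMod 2) M₃]
    {A : Submodule (ZMod 2) (M₁ × M₂ × M₃)} {W₁ : Submodule (ZMod 2) M₁}
    {W₂ : Submodule (ZMod 2) M₂} {W₃ : Submodule (ZMod 2) M₃}
    (h₁ : ∀ u ∈ W₁, (u, 0, 0) ∈ A) (h₂ : ∀ u ∈ W₂, (0, u, 0) ∈ A) (h₃ : ∀ u ∈ W₃, (0, 0, u) ∈ A) :
    W₁.prod (W₂.prod W₃) ≤ A := by
  rintro ⟨u₁, u₂, u₃⟩ ⟨hu₁, hu₂, hu₃⟩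
  have h := add_mem (add_mem (h₁ u₁ hu₁) (h₂ u₂ hu₂)) (h₃ u₃ hu₃)
  simpa using h

lemma atVertex_ofFn_mem_level {Q : Subgroup (Equiv.Perm Word)} {q : Equiv.Perm Word} (hq : q ∈ Q)
    {n : ℕ} (σ : Fin n → ZMod 2) : atVertex q (List.ofFn σ) ∈ level Q n := by
  simpa using atVertex_mem_level hq (List.ofFn σ)

lemma theta_coord_eq_zero {k : ℕ} {g : Equiv.Perm Word} (hg : g ∈ level Kt (k + 1)) :
    coord theta k g = 0 := by
  rw [← level_level_one] at hg
  exact coord_eq_zero (fun _ => theta_eq_zero_of_mem_level_Kt) hg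

lemma atVertex_x_mem_Nt {k : ℕ} (σ : Fin (k + 1) → ZMod 2) :
    atVertex x (List.ofFn σ) ∈ Nt (k + 1) :=
  Subgroup.mem_sup_left (atVertex_ofFn_mem_level x_mem_Kt σ)

lemma atVertex_y_mem_Nt {k : ℕ} (σ : Fin (k + 1) → ZMod 2) :
    atVertex y (List.ofFn σ) ∈ Nt (k + 1) :=
  Subgroup.mem_sup_left (atVertex_ofFn_mem_level y_mem_Kt σ)

lemma atVertex_x_sq_mem_Nt {k : ℕ} (σ : Fin k → ZMod 2) :
    atVertex (x ^ 2) (List.ofFn σ) ∈ Nt (k + 1) :=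
  Subgroup.mem_sup_right (atVertex_ofFn_mem_level x_sq_mem_Tt σ)

lemma phiFun_atVertex_x {k : ℕ} (σ : Fin (k + 1) → ZMod 2) :
    phiFun k (atVertex x (List.ofFn σ)) = (Pi.single σ 1, 0, 0) := by
  obtain ⟨h0, h1, -⟩ := psi_x_values
  rw [phiFun, coord_atVertex (psi_isHomOn 0).map_one, coord_atVertex (psi_isHomOn 1).map_one,
    theta_coord_eq_zero (atVertex_ofFn_mem_level x_mem_Kt σ), h0, h1, one_smul, zero_smul]

lemma phiFun_atVertex_y {k : ℕ} (σ : Fin (k + 1) → ZMod 2) :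
    phiFun k (atVertex y (List.ofFn σ)) = (0, Pi.single σ 1, 0) := by
  obtain ⟨h0, h1, -⟩ := psi_y_values
  rw [phiFun, coord_atVertex (psi_isHomOn 0).map_one, coord_atVertex (psi_isHomOn 1).map_one,
    theta_coord_eq_zero (atVertex_ofFn_mem_level y_mem_Kt σ), h0, h1, one_smul, zero_smul]

lemma phiFun_atVertex_x_sq {k : ℕ} (σ : Fin k → ZMod 2) :
    phiFun k (atVertex (x ^ 2) (List.ofFn σ)) = (0, 0, Pi.single σ 1) := by
  obtain ⟨h0, h1, -⟩ := psi_z_values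
  -- As `x² = (z, z)` and `psi 0 z = psi 1 z = 0`, its coordinates one level down vanish.
  have hz : x ^ 2 ∈ level ((psi_isHomOn 0).ker ⊓ (psi_isHomOn 1).ker) 1 := by
    rw [x_sq, node_pair_mem_level_succ]
    have h : z ∈ (psi_isHomOn 0).ker ⊓ (psi_isHomOn 1).ker :=
      ⟨⟨z_mem_lcs_two, h0⟩, ⟨z_mem_lcs_two, h1⟩⟩
    exact ⟨h, h⟩
  have hmem := atVertex_ofFn_mem_level hz σ
  rw [level_level_one] at hmem
  have hpsi : ∀ q ∈ (psi_isHomOn 0).ker ⊓ (psi_isHomOn 1).ker, psi 0 q = 0 ∧ psi 1 q = 0 :=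
    fun q hq => ⟨hq.1.2, hq.2.2⟩
  rw [phiFun, coord_eq_zero (fun q hq => (hpsi q hq).1) hmem,
    coord_eq_zero (fun q hq => (hpsi q hq).2) hmem, coord_atVertex theta_isHomOn.map_one, theta_x_sq, one_smul]

/-- The tuples with one entry `x`, `y` or `x²` map to the delta functions of the three summands, and
these span. -/
lemma exists_phiFun_eq {k : ℕ} (t : Triple k) : ∃ q ∈ Nt (k + 1), phiFun k q = t := by
  have hsingle : ∀ {n : ℕ} {U : Submodule (ZMod 2) (LevelFun n)},
      (∀ σ, Pi.single σ 1 ∈ U) → ∀ u, u ∈ U := by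
    intro n U h u
    have htop : (⊤ : Submodule (ZMod 2) (LevelFun n)) ≤ U := by
      rw [← (Pi.basisFun (ZMod 2) (Fin n → ZMod 2)).span_eq, Submodule.span_le]
      rintro _ ⟨σ, rfl⟩
      rw [Pi.basisFun_apply]
      exact h σ
    exact htop Submodule.mem_top
  have hle := prod_le_of_comap_le (A := phiImage k (le_refl (Nt (k + 1))))
    (W₁ := ⊤) (W₂ := ⊤) (W₃ := ⊤)
    (fun u _ => hsingle (U := (phiImage k le_rfl).comap (LinearMap.inl _ _ _))
      (fun σ => ⟨_, atVertex_x_mem_Nt σ, phiFun_atVertex_x σ⟩) u)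
    (fun u _ => hsingle
      (U := (phiImage k le_rfl).comap (LinearMap.inr _ _ _ ∘ₗ LinearMap.inl _ _ _))
      (fun σ => ⟨_, atVertex_y_mem_Nt σ, phiFun_atVertex_y σ⟩) u)
    (fun u _ => hsingle
      (U := (phiImage k le_rfl).comap (LinearMap.inr _ _ _ ∘ₗ LinearMap.inr _ _ _))
      (fun σ => ⟨_, atVertex_x_sq_mem_Nt σ, phiFun_atVertex_x_sq σ⟩) u)
  exact hle ⟨Submodule.mem_top, Submodule.mem_top, Submodule.mem_top⟩

-- Commutators of the filtration with `G̃`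

lemma NtFil_le (k r : ℕ) : NtFil k r ≤ Nt (k + 1) := fun _ h => h.1

lemma commutator_NtFil_le_NtFil (k r : ℕ) : ⁅NtFil k r, Gt⁆ ≤ NtFil k (r + 1) := by
  rw [Subgroup.commutator_le]
  rintro q ⟨hq, h1, h2, h3⟩ g hg
  refine ⟨(normBy_Nt _).commutator_le (Subgroup.commutator_mem_commutator hq hg), ?_⟩
  rw [phiFun_commutator hg hq]
  exact ⟨act_sub_mem g h1, act_sub_mem g h2, act_sub_mem g h3⟩

lemma normBy_NtFil (k r : ℕ) : NormBy Gt (NtFil k r) := by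
  intro g hg q hq
  have h1 := (NtFil_le k r) hq
  have h2 : g * q * g⁻¹ = ⁅g, q⁆ * q := by rw [commutatorElement_def, inv_mul_cancel_right]
  have hanti : NtFil k (r + 1) ≤ NtFil k r := fun q hq =>
    ⟨hq.1, Wfil_anti (Nat.le_succ r) hq.2.1, Wfil_anti (Nat.le_succ r) hq.2.2.1,
      Wfil_anti (Nat.le_succ r) hq.2.2.2⟩
  rw [h2, ← commutatorElement_inv]
  exact mul_mem (inv_mem (hanti (commutator_NtFil_le_NtFil k r
    (Subgroup.commutator_mem_commutator hq hg)))) hq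

/-- Its only non-zero coordinate is the constant function in the first summand, which lies in the
last non-zero layer and so in every layer with `r < 2 ^ (k + 1)`. -/
lemma diag_x_mem_NtFil {k r : ℕ} (hr : r < 2 ^ (k + 1)) : diag x (k + 1) ∈ NtFil k r := by
  have hmem := diag_mem_level x_mem_Kt (k + 1)
  refine ⟨Subgroup.mem_sup_left hmem, ?_⟩
  obtain ⟨h0, h1, -⟩ := psi_x_values
  rw [phiFun, coord_diag, coord_diag, theta_coord_eq_zero hmem, h0, h1, one_smul, zero_smul]
  exact ⟨w_mem_Wfil (by omega) (by omega), zero_mem _, zero_mem _⟩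

lemma Nt_le_commutator_NtFil {k r : ℕ} (hr : r < 2 ^ (k + 1)) :
    Nt (k + 2) ≤ ⁅NtFil k r, Gt⁆ := by
  have hx := diag_x_mem_NtFil hr
  exact Nt_le_of_commutator_diag_mem (normBy_NtFil k r).commutator
    (Subgroup.commutator_mem_commutator hx b_mem_Gt)
    (Subgroup.commutator_mem_commutator hx c_mem_Gt)
    (Subgroup.commutator_mem_commutator hx d_mem_Gt)

/-- Applied with `ι` the inclusion of each of the three summands. A commutator with a suitable
generator has the required leading term, and `Wfil_le_of_approx` removes the error terms. -/
lemma Wfil_le_comap_phiImage {k r n : ℕ} (ι : LevelFun n →ₗ[ZMod 2] Triple k)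
    (hfil : ∀ f ∈ Wfil n r, ι f ∈ tripleFil k r)
    (hact : ∀ g f, actTriple k g (ι f) = ι (act n g f))
    (hH : ⁅NtFil k r, Gt⁆ ≤ Nt (k + 1)) : Wfil n (r + 1) ≤ (phiImage k hH).comap ι := by
  apply Wfil_le_of_approx
  intro s hs hs'
  -- The target of index `s + 1` is reached from the basis function of index `s`, still in layer
  -- `r`.
  obtain ⟨s, rfl⟩ := Nat.exists_eq_add_of_le' (show 1 ≤ s by omega)
  obtain ⟨g, hg, H⟩ := exists_act_w hs'
  obtain ⟨q, hq, hq'⟩ := exists_phiFun_eq (ι (w n s))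
  have hq2 : q ∈ NtFil k r := ⟨hq, by rw [hq']; exact hfil _ (w_mem_Wfil (by omega) (by omega))⟩
  refine ⟨act n g (w n s) - w n s, ⟨⁅q, g⁆, Subgroup.commutator_mem_commutator hq2 hg, ?_⟩, H⟩
  rw [phiFun_commutator hg hq, hq', hact, map_sub]

/-- The two sides have the same coordinates, and the left side already contains their kernel by
`Nt_le_commutator_NtFil`, so they agree as groups. -/
lemma commutator_NtFil {k r : ℕ} (hr : r < 2 ^ (k + 1)) : ⁅NtFil k r, Gt⁆ = NtFil k (r + 1) := by
  apply le_antisymm (commutator_NtFil_le_NtFil k r)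
  have hH : ⁅NtFil k r, Gt⁆ ≤ Nt (k + 1) :=
    (commutator_NtFil_le_NtFil k r).trans (NtFil_le _ _)
  have hle : tripleFil k (r + 1) ≤ phiImage k hH := by
    apply prod_le_of_comap_le
    · exact Wfil_le_comap_phiImage (LinearMap.inl _ _ _)
        (fun f hf => ⟨hf, zero_mem _, zero_mem _⟩) (fun g f => by simp [actTriple]) hH
    · exact Wfil_le_comap_phiImage (LinearMap.inr _ _ _ ∘ₗ LinearMap.inl _ _ _)
        (fun f hf => ⟨zero_mem _, hf, zero_mem _⟩) (fun g f => by simp [actTriple]) hH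
    · exact Wfil_le_comap_phiImage (LinearMap.inr _ _ _ ∘ₗ LinearMap.inr _ _ _)
        (fun f hf => ⟨zero_mem _, zero_mem _, hf⟩) (fun g f => by simp [actTriple]) hH
  rintro g ⟨hg, hg'⟩
  obtain ⟨q, hq, hq'⟩ := hle hg'
  have h1 : g * q⁻¹ ∈ Nt (k + 2) := by
    rw [← phiFun_eq_zero_iff (mul_mem hg (inv_mem (hH hq))), phiFun_mul hg (inv_mem (hH hq)),
      phiFun_inv (hH hq), hq', triple_add_self]
  have h2 := mul_mem (Nt_le_commutator_NtFil hr h1) hq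
  rwa [inv_mul_cancel_right] at h2

/-- The lower central series of `G̃`. -/
lemma lcs_eq_NtFil {k r : ℕ} (hr : r ≤ 2 ^ (k + 1)) :
    lcs Gt (2 ^ (k + 1) + 1 + r) = NtFil k r := by
  have step : ∀ k r, lcs Gt (2 ^ (k + 1) + 1) = Nt (k + 1) → r ≤ 2 ^ (k + 1) →
      lcs Gt (2 ^ (k + 1) + 1 + r) = NtFil k r := by
    intro k r h hr
    induction r with
    | zero => rw [add_zero, h, NtFil_zero]
    | succ r ih =>
      rw [← add_assoc, lcs_succ _ (by omega), ih (by omega), commutator_NtFil (by omega)]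
  refine step k r ?_ hr
  clear hr
  induction k with
  | zero => exact lcs_three_eq
  | succ k ih =>
    rw [show 2 ^ (k + 1 + 1) + 1 = 2 ^ (k + 1) + 1 + 2 ^ (k + 1) by ring, step k _ ih le_rfl,
      NtFil_two_pow]

/-! ### The isomorphism -/

/-- The map `α ⊕ β ⊕ γ` on `Ñ_{k+1}`. -/
def phi (k : ℕ) : Nt (k + 1) →* Multiplicative (V (k + 1) × V (k + 1) × V (k + 1 - 1)) where
  toFun g := Multiplicative.ofAdd (toV (k + 1) (phiFun k g).1, toV (k + 1) (phiFun k g).2.1,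
    toV k (phiFun k g).2.2)
  map_one' := by
    rw [Subgroup.coe_one, phiFun_one]
    simp only [Prod.fst_zero, Prod.snd_zero, map_zero]
    rfl
  map_mul' g h := by
    rw [Subgroup.coe_mul, phiFun_mul g.2 h.2]
    simp only [Prod.fst_add, Prod.snd_add, map_add]
    rfl

lemma phi_isAlphaBetaGamma (k : ℕ) : IsAlphaBetaGamma (k + 1) (phi k) where
  surjective t := by
    obtain ⟨t₁, t₂, t₃⟩ := t
    obtain ⟨q, hq, hq'⟩ := exists_phiFun_eq
      ((toV (k + 1)).symm t₁, (toV (k + 1)).symm t₂, (toV k).symm t₃)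
    refine ⟨⟨q, hq⟩, ?_⟩
    simp only [phi, MonoidHom.coe_mk, OneHom.coe_mk, hq', LinearEquiv.apply_symm_apply]
    rfl
  ker := by
    have hker : ∀ g : Nt (k + 1), phi k g = 1 ↔ phiFun k g = 0 := by
      intro g
      change (toV (k + 1) (phiFun k g).1, toV (k + 1) (phiFun k g).2.1,
        toV k (phiFun k g).2.2) = 0 ↔ _
      simp only [Prod.ext_iff, Prod.fst_zero, Prod.snd_zero, LinearEquiv.map_eq_zero_iff]
    ext g
    rw [Subgroup.mem_map]
    constructor
    · rintro ⟨g, hg, rfl⟩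
      exact (phiFun_eq_zero_iff g.2).1 ((hker g).1 hg)
    · intro hg
      have hg' := Nt_succ_succ_le k hg
      exact ⟨⟨g, hg'⟩, (hker _).2 ((phiFun_eq_zero_iff hg').2 hg), rfl⟩
  map_x σ := by
    refine ⟨atVertex_x_mem_Nt σ, ?_⟩
    simp only [phi, MonoidHom.coe_mk, OneHom.coe_mk, phiFun_atVertex_x, map_zero, toV_single]
  map_y σ := by
    refine ⟨atVertex_y_mem_Nt σ, ?_⟩
    simp only [phi, MonoidHom.coe_mk, OneHom.coe_mk, phiFun_atVertex_y, map_zero, toV_single]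
  map_x_sq σ := by
    refine ⟨atVertex_x_sq_mem_Nt (k := k) σ, ?_⟩
    simp only [phi, MonoidHom.coe_mk, OneHom.coe_mk]
    rw [phiFun_atVertex_x_sq (k := k) σ]
    simp only [map_zero]
    exact congrArg (fun t => Multiplicative.ofAdd ((0, 0, t) : V (k + 1) × V (k + 1) × V k))
      (toV_single (n := k) σ)

lemma mem_alphaInv_phi {k r : ℕ} {g : Equiv.Perm Word} :
    g ∈ alphaInv (phi k) (Vfil (k + 1) r) ↔
      g ∈ Nt (k + 1) ∧ ∃ u ∈ Wfil (k + 1) r, phiFun k g = (u, 0, 0) := by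
  rw [alphaInv, Subgroup.mem_map]
  constructor
  · rintro ⟨g, ⟨h1, h2⟩, rfl⟩
    obtain ⟨h2, h3⟩ := Prod.ext_iff.1 ((Submodule.mem_bot _).1 h2)
    exact ⟨g.2, _, toV_mem_Vfil.1 h1, Prod.ext rfl (Prod.ext
      ((toV _).map_eq_zero_iff.1 h2) ((toV _).map_eq_zero_iff.1 h3))⟩
  · rintro ⟨hg, u, hu, h⟩
    refine ⟨⟨g, hg⟩, ⟨?_, ?_⟩, rfl⟩
    · change toV _ (phiFun k g).1 ∈ _
      rw [h]
      exact toV_mem_Vfil.2 hu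
    · change (toV _ (phiFun k g).2.1, toV _ (phiFun k g).2.2) = 0
      rw [h]
      simp

lemma mem_betaInv_phi {k r : ℕ} {g : Equiv.Perm Word} :
    g ∈ betaInv (phi k) (Vfil (k + 1) r) ↔
      g ∈ Nt (k + 1) ∧ ∃ u ∈ Wfil (k + 1) r, phiFun k g = (0, u, 0) := by
  rw [betaInv, Subgroup.mem_map]
  constructor
  · rintro ⟨g, ⟨h1, h2, h3⟩, rfl⟩
    exact ⟨g.2, _, toV_mem_Vfil.1 h2, Prod.ext ((toV _).map_eq_zero_iff.1 h1) (Prod.ext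
      rfl ((toV _).map_eq_zero_iff.1 h3))⟩
  · rintro ⟨hg, u, hu, h⟩
    refine ⟨⟨g, hg⟩, ⟨?_, ?_, ?_⟩, rfl⟩
    · change toV _ (phiFun k g).1 = 0
      rw [h, map_zero]
    · change toV _ (phiFun k g).2.1 ∈ _
      rw [h]
      exact toV_mem_Vfil.2 hu
    · change toV _ (phiFun k g).2.2 = 0
      rw [h, map_zero]

lemma mem_gammaInv_phi {k r : ℕ} {g : Equiv.Perm Word} :
    g ∈ gammaInv (phi k) (Vfil (k + 1 - 1) r) ↔
      g ∈ Nt (k + 1) ∧ ∃ u ∈ Wfil k r, phiFun k g = (0, 0, u) := by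
  rw [gammaInv, Subgroup.mem_map]
  constructor
  · rintro ⟨g, ⟨h1, h2, h3⟩, rfl⟩
    exact ⟨g.2, _, toV_mem_Vfil.1 h3, Prod.ext ((toV _).map_eq_zero_iff.1 h1) (Prod.ext
      ((toV _).map_eq_zero_iff.1 h2) rfl)⟩
  · rintro ⟨hg, u, hu, h⟩
    refine ⟨⟨g, hg⟩, ⟨?_, ?_, ?_⟩, rfl⟩
    · change toV _ (phiFun k g).1 = 0
      rw [h, map_zero]
    · change toV _ (phiFun k g).2.1 = 0
      rw [h, map_zero]
    · change toV k (phiFun k g).2.2 ∈ Vfil k r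
      rw [h]
      exact toV_mem_Vfil.2 hu

lemma NtFil_eq_mul (k r : ℕ) :
    (NtFil k r : Set (Equiv.Perm Word)) =
      (Nt (k + 1 + 1) : Set (Equiv.Perm Word)) *
        (alphaInv (phi k) (Vfil (k + 1) r) : Set (Equiv.Perm Word)) *
        (betaInv (phi k) (Vfil (k + 1) r) : Set (Equiv.Perm Word)) *
        (gammaInv (phi k) (Vfil (k + 1 - 1) r) : Set (Equiv.Perm Word)) := by
  ext g
  simp only [Set.mem_mul, SetLike.mem_coe, mem_alphaInv_phi, mem_betaInv_phi, mem_gammaInv_phi]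
  constructor
  · rintro ⟨hg, h1, h2, h3⟩
    obtain ⟨q₁, hq₁, e₁⟩ := exists_phiFun_eq (k := k) ((phiFun k g).1, 0, 0)
    obtain ⟨q₂, hq₂, e₂⟩ := exists_phiFun_eq (k := k) (0, (phiFun k g).2.1, 0)
    obtain ⟨q₃, hq₃, e₃⟩ := exists_phiFun_eq (k := k) (0, 0, (phiFun k g).2.2)
    have hq := mul_mem (mul_mem hq₁ hq₂) hq₃
    have e : phiFun k (q₁ * q₂ * q₃) = phiFun k g := by
      rw [phiFun_mul (mul_mem hq₁ hq₂) hq₃, phiFun_mul hq₁ hq₂, e₁, e₂, e₃]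
      simp
    -- Each `q_i` realises one component of the coordinates of `g`; the quotient of `g` by their
    -- product has zero coordinates and hence lies in the next `Nt`.
    refine ⟨_, ⟨_, ⟨g * (q₁ * q₂ * q₃)⁻¹, ?_, q₁, ⟨hq₁, _, h1, e₁⟩, rfl⟩, q₂, ⟨hq₂, _, h2, e₂⟩,
      rfl⟩, q₃, ⟨hq₃, _, h3, e₃⟩, by group⟩
    rw [← phiFun_eq_zero_iff (mul_mem hg (inv_mem hq)), phiFun_mul hg (inv_mem hq),
      phiFun_inv hq, e, triple_add_self]
  · rintro ⟨_, ⟨_, ⟨n, hn, q₁, ⟨hq₁, u₁, hu₁, e₁⟩, rfl⟩, q₂, ⟨hq₂, u₂, hu₂, e₂⟩, rfl⟩, q₃,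
      ⟨hq₃, u₃, hu₃, e₃⟩, rfl⟩
    have hn' := Nt_succ_succ_le k hn
    have e : phiFun k (n * q₁ * q₂ * q₃) = (u₁, u₂, u₃) := by
      rw [phiFun_mul (mul_mem (mul_mem hn' hq₁) hq₂) hq₃, phiFun_mul (mul_mem hn' hq₁) hq₂,
        phiFun_mul hn' hq₁, (phiFun_eq_zero_iff hn').2 hn, e₁, e₂, e₃]
      simp
    refine ⟨mul_mem (mul_mem (mul_mem hn' hq₁) hq₂) hq₃, ?_⟩
    rw [e]
    exact ⟨hu₁, hu₂, hu₃⟩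

/-! ### The lower central factors -/

/-- An `𝔽₂`-vector space is not changed by tensoring with `𝔽₂` over the integers. -/
lemma finrank_zmod_two_tensor (E : Type*) [AddCommGroup E] [Module (ZMod 2) E] :
    Module.finrank (ZMod 2) (ZMod 2 ⊗[ℤ] E) = Module.finrank (ZMod 2) E := by
  let f : E →+ ZMod 2 ⊗[ℤ] E := (TensorProduct.mk ℤ (ZMod 2) E 1).toAddMonoidHom
  let h : ZMod 2 ⊗[ℤ] E →ₗ[ℤ] E := TensorProduct.lift
    (LinearMap.mk₂ ℤ (fun (s : ZMod 2) (u : E) => s • u) (fun _ _ _ => add_smul _ _ _)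
      (fun _ _ _ => smul_assoc _ _ _) (fun _ _ _ => smul_add _ _ _)
      (fun _ _ _ => smul_comm _ _ _))
  have hf : ∀ u, h (f u) = u := fun u => one_smul (ZMod 2) u
  refine (LinearEquiv.finrank_eq (LinearEquiv.ofBijective (f.toZModLinearMap 2)
    ⟨Function.LeftInverse.injective hf, fun t => ?_⟩)).symm
  induction t using TensorProduct.induction_on with
  | zero => exact ⟨0, map_zero _⟩
  | tmul s u =>
    rcases zmod_two_cases s with rfl | rfl
    · exact ⟨0, by simp⟩
    · exact ⟨u, rfl⟩
  | add t₁ t₂ h₁ h₂ =>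
    obtain ⟨u₁, rfl⟩ := h₁
    obtain ⟨u₂, rfl⟩ := h₂
    exact ⟨u₁ + u₂, map_add _ _ _⟩

lemma rank₂_eq_finrank {M E : Type*} [CommGroup M] [AddCommGroup E] [Module (ZMod 2) E]
    (e : M ≃* Multiplicative E) : rank₂ M = Module.finrank (ZMod 2) E := by
  rw [rank₂, ← finrank_zmod_two_tensor E]
  let e' : Additive M ≃ₗ[ℤ] E := (MulEquiv.toAdditiveLeft e).toIntLinearEquiv
  exact LinearEquiv.finrank_eq (TensorProduct.AlgebraTensorModule.congr
    (LinearEquiv.refl (ZMod 2) (ZMod 2)) e')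

/-- A lower central factor which is identified by `f` with a quotient `W / W'` of `𝔽₂`-vector
spaces. -/
lemma lcFactor_of_map {P M : Type*} [Group P] [AddCommGroup M] [Module (ZMod 2) M] [Finite M]
    {G : Subgroup P} {n : ℕ} (f : P → M) {W W' : Submodule (ZMod 2) M} (hle : W' ≤ W)
    (hmul : ∀ g ∈ lcs G n, ∀ h ∈ lcs G n, f (g * h) = f g + f h)
    (hmem : ∀ g ∈ lcs G n, f g ∈ W) (hsurj : ∀ t ∈ W, ∃ g ∈ lcs G n, f g = t)
    (hker : ∀ g ∈ lcs G n, f g ∈ W' ↔ g ∈ lcs G (n + 1)) :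
    (∀ q : LCFactor G n, q ^ 2 = 1) ∧
      rank₂ (LCFactor G n) = Module.finrank (ZMod 2) W - Module.finrank (ZMod 2) W' ∧
      (lcs G (n + 1)).relIndex (lcs G n) =
        2 ^ (Module.finrank (ZMod 2) W - Module.finrank (ZMod 2) W') := by
  let F : lcs G n →* Multiplicative (W ⧸ W'.submoduleOf W) := MonoidHom.mk'
    (fun g => Multiplicative.ofAdd (Submodule.Quotient.mk ⟨f g, hmem g g.2⟩)) (by
      intro g h
      rw [← ofAdd_add, ← Submodule.Quotient.mk_add]
      congr 3
      exact hmul g g.2 h h.2)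
  have hF : Function.Surjective F := by
    intro t
    obtain ⟨⟨u, hu⟩, hu'⟩ := Submodule.Quotient.mk_surjective _ (Multiplicative.toAdd t)
    obtain ⟨g, hg, rfl⟩ := hsurj u hu
    exact ⟨⟨g, hg⟩, hu'⟩
  have hFker : F.ker = (lcs G (n + 1)).subgroupOf (lcs G n) := by
    ext g
    rw [MonoidHom.mem_ker, Subgroup.mem_subgroupOf, ← hker g g.2]
    exact (Submodule.Quotient.mk_eq_zero (W'.submoduleOf W)).trans Submodule.mem_comap
  have e : LCFactor G n ≃* Multiplicative (W ⧸ W'.submoduleOf W) :=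
    (QuotientGroup.quotientMulEquivOfEq hFker.symm).trans
      (QuotientGroup.quotientKerEquivOfSurjective F hF)
  have hrank : Module.finrank (ZMod 2) (W ⧸ W'.submoduleOf W) =
      Module.finrank (ZMod 2) W - Module.finrank (ZMod 2) W' := by
    have h := (W'.submoduleOf W).finrank_quotient_add_finrank
    rw [(Submodule.submoduleOfEquivOfLe hle).finrank_eq] at h
    omega
  refine ⟨fun q => ?_, by rw [rank₂_eq_finrank e, hrank], ?_⟩
  · apply e.injective
    rw [map_pow, map_one, pow_two]
    apply Multiplicative.toAdd.injective
    rw [toAdd_mul, toAdd_one, ← two_smul (ZMod 2), show (2 : ZMod 2) = 0 from rfl, zero_smul]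
  · have h1 : (lcs G (n + 1)).relIndex (lcs G n) = Nat.card (LCFactor G n) := rfl
    have h2 : Nat.card (W ⧸ W'.submoduleOf W) =
        2 ^ Module.finrank (ZMod 2) (W ⧸ W'.submoduleOf W) := by
      rw [Module.natCard_eq_pow_finrank (K := ZMod 2), Nat.card_zmod]
    rw [h1, Nat.card_congr e.toEquiv, ← hrank]
    exact h2

/-- The exponent and the index of a lower central factor of `G̃` with known rank. -/
def FactorHasRank (n k : ℕ) : Prop :=
  (∀ q : LCFactor Gt n, q ^ 2 = 1) ∧ rank₂ (LCFactor Gt n) = k ∧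
    (lcs Gt (n + 1)).relIndex (lcs Gt n) = 2 ^ k

lemma factorHasRank_one : FactorHasRank 1 4 := by
  let f : Equiv.Perm Word → (Fin 4 → ZMod 2) := fun g i => sgn i g
  have hf : ∀ g ∈ Gt, ∀ h ∈ Gt, f (g * h) = f g + f h :=
    fun g hg h hh => funext fun i => sgn_isHomOn i g hg h hh
  have hsurj : ∀ t : Fin 4 → ZMod 2, ∃ g ∈ Gt, f g = t := by
    intro t
    -- `sgn 2` detects `d` and `sgn 3` detects `c`, so `t 2` and `t 3` are exchanged relative to the
    -- order of the generators.
    refine ⟨a ^ (t 0).val * b ^ (t 1).val * c ^ (t 3).val * d ^ (t 2).val * 1,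
      mul_mem (mul_mem (mul_mem (mul_mem (pow_mem a_mem_Gt _) (pow_mem b_mem_Gt _))
        (pow_mem c_mem_Gt _)) (pow_mem d_mem_Gt _)) (one_mem _), ?_⟩
    ext i
    change sgn i _ = _
    rw [sgn_abcd (one_mem _)]
    simp only [ZMod.natCast_val, ZMod.cast_id', id_eq]
    fin_cases i <;>
    simp [sgn_succ_a, sgn_succ_b, sgn_succ_c, sgn_succ_d, sgn_zero_a, sgn_zero_b, sgn_zero_c,
      sgn_zero_d]
  have h := lcFactor_of_map (G := Gt) (n := 1) f (W := ⊤) (W' := ⊥) bot_le hf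
    (fun _ _ => Submodule.mem_top) (fun t _ => hsurj t) (fun g hg => by
      rw [Submodule.mem_bot]
      constructor
      · intro h
        exact mem_lcs_two_of_sgn_eq_zero hg fun m hm => congrFun h ⟨m, hm⟩
      · intro h
        exact funext fun i => sgn_eq_zero_of_mem_lcs_two i h)
  simpa [FactorHasRank] using h

lemma factorHasRank_two : FactorHasRank 2 3 := by
  let f : Equiv.Perm Word → (Fin 3 → ZMod 2) := fun g i => psi i g
  have hf : ∀ g ∈ lcs Gt 2, ∀ h ∈ lcs Gt 2, f (g * h) = f g + f h :=
    fun g hg h hh => funext fun i => psi_isHomOn i g hg h hh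
  have hsurj : ∀ t : Fin 3 → ZMod 2, ∃ g ∈ lcs Gt 2, f g = t := by
    intro t
    refine ⟨x ^ (t 0).val * y ^ (t 1).val * z ^ (t 2).val * 1,
      mul_mem (mul_mem (mul_mem (pow_mem x_mem_lcs_two _) (pow_mem y_mem_lcs_two _))
        (pow_mem z_mem_lcs_two _)) (one_mem _), ?_⟩
    ext i
    change psi i _ = _
    obtain ⟨hx0, hx1, hx2⟩ := psi_x_values
    obtain ⟨hy0, hy1, hy2⟩ := psi_y_values
    obtain ⟨hz0, hz1, hz2⟩ := psi_z_values
    rw [psi_xyz (one_mem _)]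
    simp only [ZMod.natCast_val, ZMod.cast_id', id_eq]
    fin_cases i <;> simp [hx0, hx1, hx2, hy0, hy1, hy2, hz0, hz1, hz2]
  have h := lcFactor_of_map (G := Gt) (n := 2) f (W := ⊤) (W' := ⊥) bot_le hf
    (fun _ _ => Submodule.mem_top) (fun t _ => hsurj t) (fun g hg => by
      rw [Submodule.mem_bot, lcs_three_eq]
      constructor
      · intro h
        exact mem_Nt_one_of_psi_eq_zero hg fun m hm => congrFun h ⟨m, hm⟩
      · intro h
        exact funext fun i => (Nt_one_le_ker_psi i h).2)
  simpa [FactorHasRank] using h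

lemma finrank_submodule_prod {M₁ M₂ : Type*} [AddCommGroup M₁] [AddCommGroup M₂]
    [Module (ZMod 2) M₁] [Module (ZMod 2) M₂] [Module.Finite (ZMod 2) M₁]
    [Module.Finite (ZMod 2) M₂] (W₁ : Submodule (ZMod 2) M₁) (W₂ : Submodule (ZMod 2) M₂) :
    Module.finrank (ZMod 2) (W₁.prod W₂) =
      Module.finrank (ZMod 2) W₁ + Module.finrank (ZMod 2) W₂ := by
  rw [← Module.finrank_prod]
  exact LinearEquiv.finrank_eq
    { toFun := fun t => (⟨t.1.1, t.2.1⟩, ⟨t.1.2, t.2.2⟩)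
      invFun := fun t => ⟨(t.1, t.2), t.1.2, t.2.2⟩
      left_inv := fun _ => rfl
      right_inv := fun _ => rfl
      map_add' := fun _ _ => rfl
      map_smul' := fun _ _ => rfl }

/-- The truncated differences are intended: the third term stays at zero from `r = 2 ^ k` on, and
there the drop per step changes from 3 to 2. -/
lemma finrank_tripleFil (k r : ℕ) :
    Module.finrank (ZMod 2) (tripleFil k r) = 2 * (2 ^ (k + 1) - r) + (2 ^ k - r) := by
  rw [tripleFil, finrank_submodule_prod, finrank_submodule_prod, finrank_Wfil, finrank_Wfil]
  ring

lemma tripleFil_succ_le (k r : ℕ) : tripleFil k (r + 1) ≤ tripleFil k r :=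
  Submodule.prod_mono (Wfil_anti (Nat.le_succ r))
    (Submodule.prod_mono (Wfil_anti (Nat.le_succ r)) (Wfil_anti (Nat.le_succ r)))

lemma factorHasRank_of_lt {k r : ℕ} (hr : r < 2 ^ (k + 1)) :
    FactorHasRank (2 ^ (k + 1) + 1 + r) (if r < 2 ^ k then 3 else 2) := by
  have h0 := lcs_eq_NtFil (k := k) hr.le
  have h1 : lcs Gt (2 ^ (k + 1) + 1 + r + 1) = NtFil k (r + 1) := lcs_eq_NtFil hr
  have h := lcFactor_of_map (G := Gt) (n := 2 ^ (k + 1) + 1 + r) (phiFun k)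
    (tripleFil_succ_le k r)
    (fun g hg h hh => by
      rw [h0] at hg hh
      exact phiFun_mul hg.1 hh.1)
    (fun g hg => by
      rw [h0] at hg
      exact hg.2)
    (fun t ht => by
      obtain ⟨q, hq, rfl⟩ := exists_phiFun_eq t
      exact ⟨q, by rw [h0]; exact ⟨hq, ht⟩, rfl⟩)
    (fun g hg => by
      rw [h0] at hg
      rw [h1, mem_NtFil]
      exact ⟨fun h => ⟨hg.1, h⟩, fun h => h.2⟩)
  rw [finrank_tripleFil, finrank_tripleFil] at h
  have hrank : 2 * (2 ^ (k + 1) - r) + (2 ^ k - r) -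
      (2 * (2 ^ (k + 1) - (r + 1)) + (2 ^ k - (r + 1))) = if r < 2 ^ k then 3 else 2 := by
    split_ifs <;> omega
  rwa [hrank] at h

lemma exists_factorHasRank {n : ℕ} (hn : 1 ≤ n) : ∃ k ≤ 4, FactorHasRank n k := by
  obtain rfl | rfl | hn : n = 1 ∨ n = 2 ∨ 3 ≤ n := by omega
  · exact ⟨4, le_rfl, factorHasRank_one⟩
  · exact ⟨3, by norm_num, factorHasRank_two⟩
  -- The stretch containing `n` is given by `2 ^ (k + 1) ≤ n - 1 < 2 ^ (k + 2)`.
  · have h1 : 1 ≤ Nat.log 2 (n - 1) := Nat.log_pos one_lt_two (by omega)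
    obtain ⟨k, hk⟩ := Nat.exists_eq_add_of_le' h1
    have h2 := Nat.pow_log_le_self 2 (show n - 1 ≠ 0 by omega)
    have h3 := Nat.lt_pow_succ_log_self one_lt_two (n - 1)
    rw [hk] at h2 h3
    rw [Nat.succ_eq_add_one, pow_succ _ (k + 1)] at h3
    have h := factorHasRank_of_lt (k := k) (r := n - (2 ^ (k + 1) + 1)) (by omega)
    rw [Nat.add_sub_cancel' (show 2 ^ (k + 1) + 1 ≤ n by omega)] at h
    refine ⟨_, ?_, h⟩
    split_ifs <;> norm_num

/-! ### Residual properties -/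

lemma apply_nil_of_mem_Gt {g : Equiv.Perm Word} (hg : g ∈ Gt) : g [] = [] := by
  obtain ⟨i, p, -, rfl⟩ := exists_wreath_of_mem_Gt hg
  simp [node_apply_nil, aPow_apply_nil]

lemma apply_eq_self_of_mem_level {Q : Subgroup (Equiv.Perm Word)} (hQ : ∀ q ∈ Q, q [] = [])
    {w : Word} {g : Equiv.Perm Word} (hg : g ∈ level Q w.length) : g w = w := by
  induction w generalizing g with
  | nil => exact hQ g hg
  | cons s w ih =>
    obtain ⟨p, hp, rfl⟩ := mem_level_succ.1 hg
    rw [node_apply_cons, ih (hp s)]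

/-- The terms `Nt (l + 1)` act only below level `l`, so an element of all of them fixes every word.
-/
lemma isResiduallyNilpotent_Gt : IsResiduallyNilpotent Gt := by
  rw [IsResiduallyNilpotent, eq_bot_iff]
  intro g hg
  rw [Subgroup.mem_iInf] at hg
  rw [Subgroup.mem_bot]
  ext1 w
  have h := hg (2 ^ (w.length + 1) + 1 + 0)
  rw [lcs_eq_NtFil (Nat.zero_le _), NtFil_zero, Nt_succ_eq] at h
  exact apply_eq_self_of_mem_level
    (fun q hq => apply_nil_of_mem_Gt (lcs_two_le (Nt_one_le_lcs_two hq))) h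

lemma lcs_antitone {P : Type*} [Group P] (G : Subgroup P) {m n : ℕ} (h : m ≤ n) :
    lcs G n ≤ lcs G m :=
  G.lowerCentralSeries_antitone (Nat.sub_le_sub_right h 1)

lemma exists_relIndex_lcs_eq (n : ℕ) : ∃ k, (lcs Gt (n + 1)).relIndex Gt = 2 ^ k := by
  induction n with
  | zero => exact ⟨0, by rw [zero_add, lcs_one, Subgroup.relIndex_self, pow_zero]⟩
  | succ n ih =>
    obtain ⟨k, hk⟩ := ih
    obtain ⟨l, -, -, -, hl⟩ := exists_factorHasRank (n := n + 1) (by omega)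
    refine ⟨l + k, ?_⟩
    have h := Subgroup.relIndex_mul_relIndex _ _ _ (lcs_antitone Gt (Nat.le_succ (n + 1)))
      (lcs_antitone Gt (Nat.le_add_left 1 n))
    rw [lcs_one, hl, hk] at h
    rw [← h, pow_add]

/-- The terms of the lower central series are normal with index a power of 2 and intersect
trivially, so one of them separates `g` from the identity. -/
lemma isResiduallyP_Gt : IsResiduallyP 2 Gt := by
  intro g hg
  have h : ∃ n, (g : Equiv.Perm Word) ∉ lcs Gt (n + 1) := by
    by_contra! h
    have hmem : (g : Equiv.Perm Word) ∈ ⨅ n : ℕ, lcs Gt n :=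
      Subgroup.mem_iInf.2 fun n => lcs_antitone Gt (Nat.le_succ n) (h n)
    rw [isResiduallyNilpotent_Gt, Subgroup.mem_bot] at hmem
    exact hg (Subtype.ext hmem)
  obtain ⟨n, hn⟩ := h
  refine ⟨(lcs Gt (n + 1)).subgroupOf Gt, ⟨fun q hq p => ?_⟩, exists_relIndex_lcs_eq n, hn⟩
  exact normBy_lcs Gt (n + 1) p p.2 q hq

lemma hasFiniteCWidth_Gt : HasFiniteCWidth Gt := by
  refine ⟨isResiduallyNilpotent_Gt, 2 ^ 4, fun n hn => ?_⟩
  obtain ⟨k, hk, -, -, h⟩ := exists_factorHasRank hn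
  rw [h]
  exact ⟨by positivity, Nat.pow_le_pow_right two_pos hk⟩

end GrigorchukOvergroup

end

theorem mainTheorem4 :
    -- the lower central series at the indices `2 ^ m + 1`
    (∀ m : ℕ, 1 ≤ m →
      GrigorchukOvergroup.lcs GrigorchukOvergroup.Gt (2 ^ m + 1) = GrigorchukOvergroup.Nt m) ∧
    -- the intermediate terms
    (∀ m : ℕ, 1 ≤ m →
      ∃ Φ : GrigorchukOvergroup.Nt m →*
          Multiplicative (GrigorchukOvergroup.V m × GrigorchukOvergroup.V m ×
            GrigorchukOvergroup.V (m - 1)),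
        GrigorchukOvergroup.IsAlphaBetaGamma m Φ ∧
        ∀ r : ℕ, r ≤ 2 ^ m →
          (GrigorchukOvergroup.lcs GrigorchukOvergroup.Gt (2 ^ m + 1 + r) :
              Set (Equiv.Perm GrigorchukOvergroup.Word)) =
            (GrigorchukOvergroup.Nt (m + 1) : Set (Equiv.Perm GrigorchukOvergroup.Word)) *
              (GrigorchukOvergroup.alphaInv Φ (GrigorchukOvergroup.Vfil m r) :
                Set (Equiv.Perm GrigorchukOvergroup.Word)) *
              (GrigorchukOvergroup.betaInv Φ (GrigorchukOvergroup.Vfil m r) :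
                Set (Equiv.Perm GrigorchukOvergroup.Word)) *
              (GrigorchukOvergroup.gammaInv Φ (GrigorchukOvergroup.Vfil (m - 1) r) :
                Set (Equiv.Perm GrigorchukOvergroup.Word))) ∧
    -- the lower central factors are elementary abelian `2`-groups, of the following ranks
    (∀ n : ℕ, 1 ≤ n →
      ∀ q : GrigorchukOvergroup.LCFactor GrigorchukOvergroup.Gt n, q ^ 2 = 1) ∧
    GrigorchukOvergroup.rank₂
      (GrigorchukOvergroup.LCFactor GrigorchukOvergroup.Gt 1) = 4 ∧
    GrigorchukOvergroup.rank₂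
      (GrigorchukOvergroup.LCFactor GrigorchukOvergroup.Gt 2) = 3 ∧
    (∀ m r : ℕ, 1 ≤ m → r < 2 ^ (m - 1) →
      GrigorchukOvergroup.rank₂
        (GrigorchukOvergroup.LCFactor GrigorchukOvergroup.Gt (2 ^ m + 1 + r)) = 3) ∧
    (∀ m r : ℕ, 1 ≤ m → 2 ^ (m - 1) ≤ r → r < 2 ^ m →
      GrigorchukOvergroup.rank₂
        (GrigorchukOvergroup.LCFactor GrigorchukOvergroup.Gt (2 ^ m + 1 + r)) = 2) ∧
    -- finite width
    GrigorchukOvergroup.IsResiduallyP 2 GrigorchukOvergroup.Gt ∧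
    GrigorchukOvergroup.HasFiniteCWidth GrigorchukOvergroup.Gt := by
  refine ⟨?_, ?_, ?_, GrigorchukOvergroup.factorHasRank_one.2.1,
    GrigorchukOvergroup.factorHasRank_two.2.1, ?_, ?_, GrigorchukOvergroup.isResiduallyP_Gt,
    GrigorchukOvergroup.hasFiniteCWidth_Gt⟩
  · intro m hm
    obtain ⟨k, rfl⟩ := Nat.exists_eq_add_of_le' hm
    rw [← GrigorchukOvergroup.NtFil_zero]
    exact GrigorchukOvergroup.lcs_eq_NtFil (Nat.zero_le _)
  · intro m hm
    obtain ⟨k, rfl⟩ := Nat.exists_eq_add_of_le' hm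
    refine ⟨GrigorchukOvergroup.phi k, GrigorchukOvergroup.phi_isAlphaBetaGamma k, ?_⟩
    intro r hr
    rw [GrigorchukOvergroup.lcs_eq_NtFil hr]
    exact GrigorchukOvergroup.NtFil_eq_mul k r
  · intro n hn
    obtain ⟨k, -, h, -⟩ := GrigorchukOvergroup.exists_factorHasRank hn
    exact h
  · intro m r hm hr
    obtain ⟨k, rfl⟩ := Nat.exists_eq_add_of_le' hm
    rw [Nat.add_sub_cancel] at hr
    have h := GrigorchukOvergroup.factorHasRank_of_lt (k := k) (r := r)
      (by rw [pow_succ]; omega)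
    rw [if_pos hr] at h
    exact h.2.1
  · intro m r hm hr hr'
    obtain ⟨k, rfl⟩ := Nat.exists_eq_add_of_le' hm
    rw [Nat.add_sub_cancel] at hr
    have h := GrigorchukOvergroup.factorHasRank_of_lt hr'
    rw [if_neg (not_lt.2 hr)] at h
    exact h.2.1
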